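/- Notation. For $x\in\mathbb R^3$ let $\langle x\rangle=(1+|x|^2)^{1/2}$; $L^p_\delta$ is the space of measurable $\varphi:\mathbb R^3\to\mathbb C$ with $\|\varphi\|_{L^p_\delta}=\|\langle\cdot\rangle^\delta\varphi\|_{L^p(\mathbb R^3)}<\infty$. For $k>0$ let $\Phi_k(x,y)=\frac{e^{ik|x-y|}}{4\pi|x-y|}$. For a function $g$ put $\mathcal R_kg(x)=\int\Phi_k(x,y)g(y)\,dy$; for a compactly supported distribution $T$ let $\mathcal R_kT(x)=\langle T,\Phi_k(x,\cdot)\rangle$ in the sense of distributions in $x$, i.e. $\langle\mathcal R_kT,\varphi\rangle=\langle T,\int\Phi_k(x,\cdot)\varphi(x)\,dx\rangle$ for $\varphi\in C_c^\infty(\mathbb R^3)$. Source. Let $(\Omega,\mathcal F,\mathbb P)$ be a probability space, $D\subset\mathbb R^3$ a bounded domain and $m>2$. Let $f$ be a microlocally isotropic generalized Gaussian random distribution of rough order $-m$ and rough strength $\mu$ in $D$. This means: $f(\cdot,\omega)$ is a tempered distribution on $\mathbb R^3$ such that $\langle f,\varphi\rangle$ is a (complex, possibly degenerate) Gaussian random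 variable for every Schwartz function $\varphi$; $\mathbb E f\in C_c^\infty(\mathbb R^3)$ with $\operatorname{supp}\mathbb Ef\subset D$; $\operatorname{supp}f\subset D$ almost surely; and the covariance operator $\mathfrak C_f$, given by $(\mathfrak C_f\varphi)(\psi)=\mathbb E\big(\langle\overline{f-\mathbb Ef},\varphi\rangle\langle f-\mathbb Ef,\psi\rangle\big)$, is a classical pseudodifferential operator of order $-m$ with principal symbol $\mu(x)|\xi|^{-m}$, where $\mu\in C_c^\infty(\mathbb R^3;\mathbb R)$, $\operatorname{supp}\mu\subset D$ and $\mu\ge0$. Potential. Let $\epsilon>0$ and let $V:\mathbb R^3\to\mathbb C$ satisfy $V\in C^5(\mathbb R^3)$, $V\in L^2_{3/2+\epsilon}$ and $\partial^\alpha V\in L^\infty_{1/2+\epsilon}$ for all $|\alpha|\le2$. Theorem. Let $k>0$ be such that the operator $\mathcal R_kV:\varphi\mapsto\mathcal R_k(V\varphi)$ satisfies $q:=\|\mathcal R_kV\|_{\mathcal L(L^2_{-1/2-\epsilon},L^2_{-1/2-\epsilon})}<1$. Then almost surely $\mathcal R_kf(\cdot,\omega)$ is a function in $L^2_{-1/2-\epsilon}$,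 and there is a measurable random field $u:\Omega\times\mathbb R^3\to\mathbb C$ such that, almost surely, $u(\cdot,\omega)\in L^2_{-1/2-\epsilon}$ solves the Lippmann–Schwinger equation $$(I-\mathcal R_kV)u=-\mathcal R_kf\quad\text{a.e. in }\mathbb R^3 .$$ Almost surely, $u(\cdot,\omega)$ is, up to equality almost everywhere, the only solution of this equation in $L^2_{-1/2-\epsilon}$, and $u(\cdot,\omega)\in L^2_{-1/2-\epsilon'}$ for every $\epsilon'>0$. It is called the mild solution. It depends stably on $\mathcal R_kf$: almost surely $$\|u(\cdot,\omega)\|_{L^2_{-1/2-\epsilon}}\le\frac1{1-q}\,\|\mathcal R_kf(\cdot,\omega)\|_{L^2_{-1/2-\epsilon}},$$ and, whenever $v,G\in L^2_{-1/2-\epsilon}$ satisfy $(I-\mathcal R_kV)v=-G$, $$\|u(\cdot,\omega)-v\|_{L^2_{-1/2-\epsilon}}\le\frac1{1-q}\,\|\mathcal R_kf(\cdot,\omega)-G\|_{L^2_{-1/2-\epsilon}} .$$ -/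

import Mathlib

open MeasureTheory ProbabilityTheory Topology
open scoped SchwartzMap ENNReal

noncomputable section

namespace RandomSchrodinger

/-- Euclidean space `ℝ³`. -/
abbrev E3 : Type := EuclideanSpace ℝ (Fin 3)

/-! ### Weighted Lebesgue spaces -/

/-- The Japanese bracket `⟨x⟩ = (1 + |x|²)^{1/2}`. -/
def bracket (x : E3) : ℝ := Real.sqrt (1 + ‖x‖ ^ 2)

/-- The norm of `L^p_δ(ℝ³)`: the `L^p` norm of `⟨·⟩^δ φ` (with values in `[0, ∞]`). -/
def weightedNorm (p : ℝ≥0∞) (δ : ℝ) (φ : E3 → ℂ) : ℝ≥0∞ :=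
  eLpNorm (fun x => ((bracket x ^ δ : ℝ) : ℂ) * φ x) p volume

/-- Membership in `L^p_δ(ℝ³)`. -/
def MemWeighted (p : ℝ≥0∞) (δ : ℝ) (φ : E3 → ℂ) : Prop :=
  MemLp (fun x => ((bracket x ^ δ : ℝ) : ℂ) * φ x) p volume

/-! ### The potential -/

/-- The iterated partial derivative `∂_{α 0} ⋯ ∂_{α (n-1)} V`. -/
def partialDeriv {n : ℕ} (α : Fin n → Fin 3) (V : E3 → ℂ) (x : E3) : ℂ :=
  iteratedFDeriv ℝ n V x (fun i => EuclideanSpace.single (α i) (1 : ℝ))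

/-- The regularity and decay assumption on the potential: `V ∈ C⁵`, `V ∈ L²_{3/2+ε}`, and
`∂^α V ∈ L^∞_{1/2+ε}` for all `|α| ≤ 2`. -/
structure IsAdmissiblePotential (ε : ℝ) (V : E3 → ℂ) : Prop where
  contDiff : ContDiff ℝ 5 V
  mem_L2 : MemWeighted 2 (3 / 2 + ε) V
  mem_Linfty : ∀ (n : ℕ), n ≤ 2 → ∀ α : Fin n → Fin 3,
    MemWeighted ∞ (1 / 2 + ε) (partialDeriv α V)

/-! ### The resolvent -/

/-- The outgoing fundamental solution `Φ_k(x, y) = e^{ik|x-y|} / (4π|x-y|)` of the Helmholtz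
equation. -/
def Phi (k : ℝ) (x y : E3) : ℂ :=
  Complex.exp (Complex.I * k * ‖x - y‖) / (4 * Real.pi * ‖x - y‖)

/-- The resolvent of a function: `(R_k g)(x) = ∫ Φ_k(x, y) g(y) dy`. -/
def resolvent (k : ℝ) (g : E3 → ℂ) (x : E3) : ℂ := ∫ y, Phi k x y * g y

/-- The operator `R_k V : φ ↦ R_k (V φ)`. -/
def resolventV (k : ℝ) (V : E3 → ℂ) (φ : E3 → ℂ) : E3 → ℂ :=
  resolvent k (fun y => V y * φ y)

/-- The operator norm (with values in `[0, ∞]`) of `R_k V` on `L²_δ(ℝ³)`: the supremum of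
`‖R_k V φ‖` over the unit ball. -/
def opNormResolventV (k : ℝ) (V : E3 → ℂ) (δ : ℝ) : ℝ≥0∞ :=
  ⨆ φ : {φ : E3 → ℂ // MemWeighted 2 δ φ ∧ weightedNorm 2 δ φ ≤ 1},
    weightedNorm 2 δ (resolventV k V φ.1)

/-- The function `w` is the resolvent `R_k T = ⟨T, Φ_k(x, ·)⟩` of the compactly supported
distribution `T`, in the sense of distributions in `x`: `w` is locally integrable and
`∫ w φ = ⟨T, ∫ Φ_k(x, ·) φ(x) dx⟩` for every test function `φ`. As the function
`y ↦ ∫ Φ_k(x, y) φ(x) dx` is smooth but not Schwartz, and `T` has compact support, the pairing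
is that of `T` with any Schwartz function which agrees with it near the support of `T`. -/
def IsResolventOf (k : ℝ) (T : 𝓢'(E3, ℂ)) (w : E3 → ℂ) : Prop :=
  LocallyIntegrable w volume ∧
  ∀ φ : E3 → ℂ, ContDiff ℝ (⊤ : ℕ∞) φ → HasCompactSupport φ →
    ∃ ψ : 𝓢(E3, ℂ),
      (∀ᶠ y in 𝓝ˢ (Distribution.dsupport T), ψ y = ∫ x, Phi k x y * φ x) ∧
      ∫ x, w x * φ x = T ψ

/-- The Lippmann–Schwinger equation `(I - R_k V) u = -F` (almost everywhere on `ℝ³`). -/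
def LippmannSchwinger (k : ℝ) (V F u : E3 → ℂ) : Prop :=
  ∀ᵐ x ∂(volume : Measure E3), u x - resolventV k V u x = -F x

/-! ### Classical pseudodifferential operators -/

/-- The mixed derivative `D_x^i D_ξ^j a (x, ξ)`. -/
def mixedDeriv (i j : ℕ) (a : E3 → E3 → ℂ) (x ξ : E3) :=
  iteratedFDeriv ℝ i (fun x' => iteratedFDeriv ℝ j (a x') ξ) x

/-- The symbol class `S^s(ℝ³ × ℝ³)`. -/
def IsSymbol (s : ℝ) (a : E3 → E3 → ℂ) : Prop :=
  ContDiff ℝ (⊤ : ℕ∞) (Function.uncurry a) ∧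
  ∀ i j : ℕ, ∃ C : ℝ, ∀ x ξ : E3, ‖mixedDeriv i j a x ξ‖ ≤ C * bracket ξ ^ (s - j)

/-- `a` is a classical symbol of order `s` with homogeneous terms `h 0, h 1, h 2, …`: `h l` is
smooth away from `ξ = 0` and homogeneous of degree `s - l` in `ξ`, and for every `N`,
`a - ∑_{l < N} h l` satisfies the estimates of `S^{s-N}` in the region `|ξ| ≥ 1`. -/
def IsClassicalSymbol (s : ℝ) (a : E3 → E3 → ℂ) (h : ℕ → E3 → E3 → ℂ) : Prop :=
  IsSymbol s a ∧
  (∀ l, ContDiffOn ℝ (⊤ : ℕ∞) (Function.uncurry (h l)) {p : E3 × E3 | p.2 ≠ 0}) ∧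
  (∀ l (x ξ : E3) (t : ℝ), 0 < t → ξ ≠ 0 →
    h l x (t • ξ) = ((t ^ (s - l) : ℝ) : ℂ) * h l x ξ) ∧
  ∀ N i j : ℕ, ∃ C : ℝ, ∀ x ξ : E3, 1 ≤ ‖ξ‖ →
    ‖mixedDeriv i j (fun x' ξ' => a x' ξ' - ∑ l ∈ Finset.range N, h l x' ξ') x ξ‖
      ≤ C * bracket ξ ^ (s - N - j)

/-- The pseudodifferential operator with symbol `a`:
`(Op(a) φ)(x) = (2π)^{-3} ∫ e^{ix·ξ} a(x, ξ) (∫ e^{-iy·ξ} φ(y) dy) dξ`. -/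
def pseudoOp (a : E3 → E3 → ℂ) (φ : E3 → ℂ) (x : E3) : ℂ :=
  (1 / (2 * Real.pi) ^ 3 : ℝ) *
    ∫ ξ : E3, Complex.exp (Complex.I * (inner ℝ x ξ : ℝ)) * a x ξ *
      ∫ y : E3, Complex.exp (-Complex.I * (inner ℝ y ξ : ℝ)) * φ y

/-! ### Random distributions -/

variable {Ω : Type*} [MeasurableSpace Ω]

/-- The pointwise complex conjugate of a Schwartz function. -/
def conjSchwartz (φ : 𝓢(E3, ℂ)) : 𝓢(E3, ℂ) :=
  SchwartzMap.postcompCLM (Complex.conjCLE : ℂ →L[ℝ] ℂ) φ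

/-- `⟨f(·,ω) - 𝔼 f, φ⟩`. -/
def centered (P : Measure Ω) (f : Ω → 𝓢'(E3, ℂ)) (φ : 𝓢(E3, ℂ)) (ω : Ω) : ℂ :=
  f ω φ - ∫ ω', f ω' φ ∂P

/-- The covariance `(𝔠_f φ)(ψ) = 𝔼(⟨conj (f - 𝔼 f), φ⟩ ⟨f - 𝔼 f, ψ⟩)`, where
`⟨conj T, φ⟩ = conj ⟨T, conj φ⟩`. -/
def covarianceOp (P : Measure Ω) (f : Ω → 𝓢'(E3, ℂ)) (φ ψ : 𝓢(E3, ℂ)) : ℂ :=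
  ∫ ω, (starRingEnd ℂ) (centered P f (conjSchwartz φ) ω) * centered P f ψ ω ∂P

/-- `f` is a generalized Gaussian random distribution on `ℝ³`. -/
structure IsGaussianDistribution (P : Measure Ω) (f : Ω → 𝓢'(E3, ℂ)) : Prop where
  measurable : ∀ φ : 𝓢(E3, ℂ), Measurable (fun ω => f ω φ)
  gaussian : ∀ φ : 𝓢(E3, ℂ), HasGaussianLaw (fun ω => f ω φ) P

/-- `f` is a microlocally isotropic generalized Gaussian random distribution with rough order
`-m` and rough strength `μ` in the bounded domain `D`. -/
structure IsMicrolocallyIsotropic (P : Measure Ω) (f : Ω → 𝓢'(E3, ℂ)) (m : ℝ) (μ : E3 → ℝ)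
    (D : Set E3) : Prop where
  isGaussian : IsGaussianDistribution P f
  /-- the expectation is a function in `C_c^∞` supported in `D` -/
  expectation : ∃ g : E3 → ℂ, ContDiff ℝ (⊤ : ℕ∞) g ∧ HasCompactSupport g ∧ tsupport g ⊆ D ∧
    ∀ φ : 𝓢(E3, ℂ), ∫ ω, f ω φ ∂P = ∫ x, g x * φ x
  /-- `f` is almost surely supported in `D` -/
  support : ∀ᵐ ω ∂P, Distribution.dsupport (f ω) ⊆ D
  strength_contDiff : ContDiff ℝ (⊤ : ℕ∞) μ
  strength_compact : HasCompactSupport μ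
  strength_support : tsupport μ ⊆ D
  strength_nonneg : ∀ x, 0 ≤ μ x
  /-- the covariance operator is a classical pseudodifferential operator of order `-m` with
  principal symbol `μ(x) |ξ|^{-m}` -/
  covariance : ∃ (c : E3 → E3 → ℂ) (h : ℕ → E3 → E3 → ℂ),
    IsClassicalSymbol (-m) c h ∧
    (∀ x ξ : E3, ξ ≠ 0 → h 0 x ξ = ((μ x * ‖ξ‖ ^ (-m) : ℝ) : ℂ)) ∧
    ∀ φ ψ : 𝓢(E3, ℂ), covarianceOp P f φ ψ = ∫ x, pseudoOp c φ x * ψ x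

end RandomSchrodinger

end

open MeasureTheory ProbabilityTheory Topology
open scoped SchwartzMap ENNReal

noncomputable section

namespace RandomSchrodinger

/-! ### The Japanese bracket -/

/-! Once `R_k f` is known to lie in `L²_{-1/2-ε}`, the equation is solved by a Neumann series: `R_k
V` has norm `q < 1`, so `u = -∑ (R_k V)^n R_k f`. Uniqueness and both stability bounds come from one
absorption estimate for the difference of two solutions
(`weightedNorm_sub_le_of_lippmannSchwinger`).

The substance is that the resolvent of a random distribution is almost surely a function. Let `χ` be
a cutoff equal to `1` near `D`. The covariance symbol has order `-m ≤ 0`, so the localized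
covariance is bounded on `L²` (`exists_norm_integral_pseudoOp_le`), and `ψ ↦ ⟨f, χψ⟩` extends to a
bounded operator `X : L²(ℝ³) → L²(P)` (`exists_L2_extension`). In dimension three `χ Φ_k(x, ·)` lies
in `L²`, with norm at most a multiple of `⟨x⟩⁻¹`. Hence the field `X(χ Φ_k(x, ·))` has second moment
of size `⟨x⟩⁻²`, integrable against `⟨x⟩^{-1-2ε}` for each `ε > 0`.

For fixed `x` this field is only a class modulo null sets. A Hilbert basis expansion gives a jointly
measurable version `F` (`exists_measurable_version`), which represents `R_k f` against each fixed
test function almost surely. Separability of the test functions supported in a ball makes the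
exceptional null set independent of the test function (`exists_resolvent`).

For the deterministic part, `Vφ ∈ L²` and `⟨·⟩Vφ ∈ L¹` whenever `φ ∈ L²_{-1/2-ε}`. Splitting the
kernel at `|x-y| = 1` then puts `R_k(Vφ)` in every `L²_{-1/2-ε'}`, and `u = R_k V u - R_k f`
inherits this. -/

lemma bracket_eq_rpow (x : E3) (r : ℝ) : bracket x ^ r = (1 + ‖x‖ ^ 2) ^ (r / 2) := by
  rw [bracket, Real.sqrt_eq_rpow, ← Real.rpow_mul (by positivity)]
  congr 1
  ring

lemma one_le_bracket (x : E3) : 1 ≤ bracket x := by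
  rw [bracket, Real.one_le_sqrt]
  nlinarith [sq_nonneg ‖x‖]

lemma bracket_pos (x : E3) : 0 < bracket x := zero_lt_one.trans_le (one_le_bracket x)

lemma bracket_rpow_pos (x : E3) (r : ℝ) : 0 < bracket x ^ r := Real.rpow_pos_of_pos (bracket_pos x) r

lemma norm_le_bracket (x : E3) : ‖x‖ ≤ bracket x := by
  rw [bracket]
  exact Real.le_sqrt_of_sq_le (by linarith)

lemma continuous_bracket : Continuous bracket := by
  unfold bracket
  fun_prop

lemma continuous_bracket_rpow (r : ℝ) : Continuous fun x => bracket x ^ r :=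
  continuous_bracket.rpow_const fun x => Or.inl (bracket_pos x).ne'

/-- Peetre's inequality. -/
lemma bracket_le_bracket_mul (x y : E3) : bracket x ≤ bracket y * (1 + ‖x - y‖) := by
  have h1 : bracket x ^ 2 = 1 + ‖x‖ ^ 2 := Real.sq_sqrt (by positivity)
  have h2 : bracket y ^ 2 = 1 + ‖y‖ ^ 2 := Real.sq_sqrt (by positivity)
  have h3 : ‖x‖ ≤ ‖y‖ + ‖x - y‖ := by
    have := norm_add_le y (x - y)
    simpa using this
  have h4 : bracket x ≤ bracket y + ‖x - y‖ := by
    refine abs_le_of_sq_le_sq' ?_ (by have := bracket_pos y; positivity) |>.2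
    have := norm_le_bracket y
    nlinarith [norm_nonneg x, norm_nonneg y, norm_nonneg (x - y)]
  have := one_le_bracket y
  nlinarith [norm_nonneg (x - y)]

lemma finrank_E3 : Module.finrank ℝ E3 = 3 := by simp

lemma integrable_bracket_rpow {r : ℝ} (hr : r < -3) : Integrable fun x : E3 => bracket x ^ r := by
  have := integrable_rpow_neg_one_add_norm_sq (E := E3) (μ := volume) (r := -r)
    (by rw [finrank_E3]; push_cast; linarith)
  simpa [bracket_eq_rpow] using this

/-! ### The kernel -/

lemma norm_Phi (k : ℝ) (x y : E3) : ‖Phi k x y‖ = (4 * Real.pi * ‖x - y‖)⁻¹ := by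
  have h : ‖Complex.exp (Complex.I * k * ‖x - y‖)‖ = 1 := by
    have := Complex.norm_exp_ofReal_mul_I (k * ‖x - y‖)
    rw [← this]
    congr 2
    push_cast
    ring
  rw [Phi, norm_div, h, norm_mul, norm_mul, Complex.norm_real, Complex.norm_real, norm_norm,
    Real.norm_of_nonneg Real.pi_pos.le, one_div]
  norm_num

lemma norm_Phi_le (k : ℝ) (x y : E3) : ‖Phi k x y‖ ≤ ‖x - y‖⁻¹ := by
  rw [norm_Phi, mul_inv]
  have : (4 * Real.pi)⁻¹ ≤ 1 := inv_le_one_of_one_le₀ (by nlinarith [Real.pi_gt_three])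
  exact mul_le_of_le_one_left (by positivity) this

lemma measurable_Phi (k : ℝ) : Measurable fun p : E3 × E3 => Phi k p.1 p.2 := by
  unfold Phi
  fun_prop

lemma measurable_Phi_right (k : ℝ) (x : E3) : Measurable fun y => Phi k x y := by
  unfold Phi
  fun_prop

lemma Phi_eq_sub (k : ℝ) (x y : E3) : Phi k x y = Phi k (y - x) 0 := by
  simp [Phi, norm_sub_rev]

/-- In polar coordinates the radial density is `r² · r^{-p}`, which has no singularity for `p ≤ 2`.
-/
lemma integrableOn_norm_inv_pow {p : ℕ} (hp : p ≤ 2) (R : ℝ) :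
    IntegrableOn (fun z : E3 => (‖z‖ ^ p)⁻¹) (Metric.ball 0 R) := by
  rw [← integrable_indicator_iff measurableSet_ball]
  have h := integrable_fun_norm_addHaar (E := E3) volume
    (f := (Set.Iio R).indicator fun r : ℝ => (r ^ p)⁻¹)
  rw [finrank_E3] at h
  have e : (Metric.ball (0 : E3) R).indicator (fun z : E3 => (‖z‖ ^ p)⁻¹)
      = fun z => (Set.Iio R).indicator (fun r : ℝ => (r ^ p)⁻¹) ‖z‖ := by
    ext z
    by_cases hz : ‖z‖ < R
    · rw [Set.indicator_of_mem (mem_ball_zero_iff.2 hz), Set.indicator_of_mem (Set.mem_Iio.2 hz)]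
    · rw [Set.indicator_of_notMem (fun h => hz (mem_ball_zero_iff.1 h)),
        Set.indicator_of_notMem (fun h => hz (Set.mem_Iio.1 h))]
  rw [e, h]
  have h2 : IntegrableOn ((Set.Iio R).indicator fun r : ℝ => r ^ (2 - p)) (Set.Ioi (0 : ℝ)) := by
    rw [IntegrableOn, integrable_indicator_iff measurableSet_Iio, IntegrableOn,
      Measure.restrict_restrict measurableSet_Iio]
    refine IntegrableOn.mono_set (t := Set.Icc 0 R) ?_ ?_
    · exact (by fun_prop : Continuous fun r : ℝ => r ^ (2 - p)).continuousOn.integrableOn_Icc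
    · rintro x ⟨h1, h2⟩
      exact ⟨le_of_lt h2, le_of_lt h1⟩
  refine h2.congr_fun ?_ measurableSet_Ioi
  intro r hr
  have hr' : r ≠ 0 := ne_of_gt hr
  simp only [Set.indicator_apply, smul_eq_mul, mul_ite, mul_zero]
  split_ifs
  · rw [show (3 - 1 : ℕ) = (2 - p) + p by omega, pow_add]
    field_simp
  · rfl

/-- For `|x| < 2R` the squared singularity is integrated over a ball of radius `3R` about `x`. For
`|x| ≥ 2R` the pole is far away and `|x-y| ≥ |x|/2`, which gives the decay. -/
lemma lintegral_ball_enorm_Phi_sq_le (k R : ℝ) : ∃ C : ℝ, 0 ≤ C ∧ ∀ x : E3,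
    ∫⁻ y in Metric.ball (0 : E3) R, ‖Phi k x y‖ₑ ^ 2 ≤ ENNReal.ofReal (C * bracket x ^ (-2 : ℝ)) := by
  -- A larger ball only increases the integral. With `R ≥ 1` the far region has `|x| ≥ 1`, so `1 +
  -- |x|² ≤ 2|x|²`; together with `|x-y|² ≥ |x|²/4` this is the constant `8`.
  wlog hR : 1 ≤ R generalizing R
  · obtain ⟨C, hC, h⟩ := this 1 le_rfl
    exact ⟨C, hC, fun x => (lintegral_mono_set (Metric.ball_subset_ball (not_le.1 hR).le)).trans (h x)⟩
  set I : ℝ := ∫ z in Metric.ball (0 : E3) (3 * R), (‖z‖ ^ 2)⁻¹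
  have hI : 0 ≤ I := integral_nonneg fun z => by positivity
  set J : ℝ := volume.real (Metric.ball (0 : E3) R)
  have hb : ∀ x : E3, bracket x ^ (-2 : ℝ) = (1 + ‖x‖ ^ 2)⁻¹ := fun x => by
    rw [bracket_eq_rpow]; norm_num [Real.rpow_neg_one]
  have hle : ∀ x y : E3, ‖Phi k x y‖ₑ ^ 2 ≤ ENNReal.ofReal ((‖x - y‖ ^ 2)⁻¹) := fun x y => by
    rw [← ofReal_norm, ← ENNReal.ofReal_pow (norm_nonneg _), ← inv_pow]
    exact ENNReal.ofReal_le_ofReal (by gcongr; exact norm_Phi_le k x y)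
  refine ⟨I * (1 + (2 * R) ^ 2) + J * 8, by positivity, fun x => ?_⟩
  rw [hb]
  by_cases hx : ‖x‖ < 2 * R
  · calc ∫⁻ y in Metric.ball (0 : E3) R, ‖Phi k x y‖ₑ ^ 2
        ≤ ∫⁻ y, (Metric.ball (0 : E3) (3 * R)).indicator
            (fun z => ENNReal.ofReal ((‖z‖ ^ 2)⁻¹)) (x - y) := by
          rw [← lintegral_indicator measurableSet_ball]
          refine lintegral_mono fun y => ?_
          by_cases hy : y ∈ Metric.ball (0 : E3) R
          · have : x - y ∈ Metric.ball (0 : E3) (3 * R) := by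
              rw [mem_ball_zero_iff] at hy ⊢
              linarith [norm_sub_le x y]
            rw [Set.indicator_of_mem hy, Set.indicator_of_mem this]
            exact hle x y
          · rw [Set.indicator_of_notMem hy]
            exact zero_le
      _ = ∫⁻ z in Metric.ball (0 : E3) (3 * R), ENNReal.ofReal ((‖z‖ ^ 2)⁻¹) := by
          rw [lintegral_sub_left_eq_self
            (fun z => (Metric.ball (0 : E3) (3 * R)).indicator
              (fun z => ENNReal.ofReal ((‖z‖ ^ 2)⁻¹)) z), lintegral_indicator measurableSet_ball]
      _ = ENNReal.ofReal I := by
          rw [ofReal_integral_eq_lintegral_ofReal (integrableOn_norm_inv_pow le_rfl _)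
            (Filter.Eventually.of_forall fun z => by positivity)]
      _ ≤ _ := by
          refine ENNReal.ofReal_le_ofReal ?_
          rw [← div_eq_mul_inv, le_div_iff₀ (by positivity)]
          have h1 : 1 + ‖x‖ ^ 2 ≤ 1 + (2 * R) ^ 2 := by gcongr
          have : 0 ≤ J * 8 := by positivity
          nlinarith
  · rw [not_lt] at hx
    calc ∫⁻ y in Metric.ball (0 : E3) R, ‖Phi k x y‖ₑ ^ 2
        ≤ ∫⁻ y in Metric.ball (0 : E3) R, ENNReal.ofReal (8 * (1 + ‖x‖ ^ 2)⁻¹) := by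
          refine setLIntegral_mono' measurableSet_ball fun y hy => (hle x y).trans ?_
          refine ENNReal.ofReal_le_ofReal ?_
          rw [mem_ball_zero_iff] at hy
          have h1 : ‖x‖ / 2 ≤ ‖x - y‖ := by linarith [norm_sub_norm_le x y]
          have h2 : 1 ≤ ‖x‖ := by linarith
          have h3 : 0 < ‖x‖ := by linarith
          have h4 : 0 < ‖x - y‖ := by linarith
          rw [← div_eq_mul_inv, inv_le_comm₀ (by positivity) (by positivity), inv_div,
            div_le_iff₀ (by positivity)]
          nlinarith [pow_le_pow_left₀ (by positivity) h1 2]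
      _ = ENNReal.ofReal (J * 8 * (1 + ‖x‖ ^ 2)⁻¹) := by
          have hJ : ENNReal.ofReal J = volume (Metric.ball (0 : E3) R) :=
            ofReal_measureReal measure_ball_lt_top.ne
          rw [setLIntegral_const, mul_assoc J, mul_comm J, ← hJ, ← ENNReal.ofReal_mul (by positivity)]
      _ ≤ _ := by
          refine ENNReal.ofReal_le_ofReal (mul_le_mul_of_nonneg_right ?_ (by positivity))
          have : 0 ≤ I * (1 + (2 * R) ^ 2) := mul_nonneg hI (by positivity)
          linarith

/-! ### The resolvent on weighted spaces -/

lemma weightedNorm_sq (δ : ℝ) (φ : E3 → ℂ) :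
    weightedNorm 2 δ φ ^ 2 = ∫⁻ x, ENNReal.ofReal (bracket x ^ (2 * δ)) * ‖φ x‖ₑ ^ 2 := by
  rw [weightedNorm, eLpNorm_eq_lintegral_rpow_enorm_toReal (by norm_num) (by norm_num),
    ← ENNReal.rpow_natCast, ← ENNReal.rpow_mul]
  norm_num
  refine lintegral_congr fun x => ?_
  have h : ‖((bracket x ^ δ : ℝ) : ℂ)‖ₑ = ENNReal.ofReal (bracket x ^ δ) := by
    rw [← ofReal_norm, Complex.norm_real, Real.norm_of_nonneg (bracket_rpow_pos x δ).le]
  rw [mul_pow, h, ← ENNReal.ofReal_pow (bracket_rpow_pos x δ).le, ← Real.rpow_natCast,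
    ← Real.rpow_mul (bracket_pos x).le, mul_comm δ]
  norm_num

lemma memWeighted_iff {δ : ℝ} {φ : E3 → ℂ} :
    MemWeighted 2 δ φ ↔ AEStronglyMeasurable φ ∧ weightedNorm 2 δ φ < ∞ := by
  have hc : ∀ r : ℝ, AEStronglyMeasurable (fun x : E3 => ((bracket x ^ r : ℝ) : ℂ)) volume :=
    fun r => (Complex.continuous_ofReal.comp (continuous_bracket_rpow r)).aestronglyMeasurable
  refine ⟨fun h => ⟨?_, h.2⟩, fun h => ⟨(hc δ).mul h.1, h.2⟩⟩
  refine ((hc (-δ)).mul h.1).congr (Filter.Eventually.of_forall fun x => ?_)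
  simp only [Pi.mul_apply, ← mul_assoc, ← Complex.ofReal_mul, ← Real.rpow_add (bracket_pos x)]
  simp

lemma weightedNorm_lt_top_iff {δ : ℝ} {φ : E3 → ℂ} : weightedNorm 2 δ φ < ∞ ↔
    ∫⁻ x, ENNReal.ofReal (bracket x ^ (2 * δ)) * ‖φ x‖ₑ ^ 2 < ∞ := by
  rw [← weightedNorm_sq, ENNReal.pow_lt_top_iff]
  simp

/-- The potential of `|g|` with respect to the kernel `|Φ_k|`. -/
def absPotential (k : ℝ) (g : E3 → ℂ) (x : E3) : ℝ≥0∞ := ∫⁻ y, ‖Phi k x y‖ₑ * ‖g y‖ₑ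

lemma enorm_resolvent_le (k : ℝ) (g : E3 → ℂ) (x : E3) : ‖resolvent k g x‖ₑ ≤ absPotential k g x := by
  refine (enorm_integral_le_lintegral_enorm _).trans_eq ?_
  simp [absPotential, enorm_mul]

lemma integrable_of_absPotential_lt_top {k : ℝ} {g : E3 → ℂ} {x : E3}
    (hg : AEStronglyMeasurable g) (h : absPotential k g x < ∞) :
    Integrable fun y => Phi k x y * g y := by
  refine ⟨(measurable_Phi_right k x).aestronglyMeasurable.mul hg, ?_⟩
  simpa [HasFiniteIntegral, enorm_mul, absPotential] using h

/-- Cauchy–Schwarz applied to `√f · (√f g)`. With `f` a translated integrable kernel this is the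
pointwise half of Young's inequality `L¹ * L² ⊆ L²`. -/
lemma lintegral_mul_sq_le {α : Type*} [MeasurableSpace α] {μ : Measure α} {f g : α → ℝ≥0∞}
    (hf : AEMeasurable f μ) (hg : AEMeasurable g μ) :
    (∫⁻ a, f a * g a ∂μ) ^ 2 ≤ (∫⁻ a, f a ∂μ) * ∫⁻ a, f a * g a ^ 2 ∂μ := by
  have h := ENNReal.lintegral_mul_le_Lp_mul_Lq μ (p := 2) (q := 2)
    (by norm_num [Real.holderConjugate_iff])
    (f := fun a => f a ^ (1 / 2 : ℝ)) (g := fun a => f a ^ (1 / 2 : ℝ) * g a)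
    (hf.pow_const _) ((hf.pow_const _).mul hg)
  have e1 : ∀ a, f a ^ (1 / 2 : ℝ) * f a ^ (1 / 2 : ℝ) = f a := fun a => by
    rw [← ENNReal.rpow_add_of_nonneg _ _ (by norm_num) (by norm_num)]; norm_num
  have e2 : ∀ a, (f a ^ (1 / 2 : ℝ)) ^ (2 : ℝ) = f a := fun a => by
    rw [← ENNReal.rpow_mul]; norm_num
  simp only [Pi.mul_apply, ← mul_assoc, e1, e2] at h
  have e3 : ∀ a, (f a ^ (1 / 2 : ℝ) * g a) ^ (2 : ℝ) = f a * g a ^ 2 := fun a => by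
    rw [ENNReal.mul_rpow_of_nonneg _ _ (by norm_num), e2]; norm_num
  simp only [e3] at h
  refine (pow_le_pow_left' h 2).trans_eq ?_
  rw [mul_pow, ← ENNReal.rpow_natCast, ← ENNReal.rpow_natCast, ← ENNReal.rpow_mul,
    ← ENNReal.rpow_mul]
  norm_num

/-- The singularity is kept where `|x-y| < 1`. Elsewhere Peetre's inequality gives `⟨x⟩ ≤
2⟨y⟩|x-y|`, which trades the kernel for `2⟨x⟩⁻¹⟨y⟩`. -/
lemma absPotential_le (k : ℝ) {g : E3 → ℂ} (hg : AEStronglyMeasurable g) (x : E3) :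
    absPotential k g x ≤
      (∫⁻ y, (Metric.ball (0 : E3) 1).indicator (fun z => ENNReal.ofReal (‖z‖ ^ 1)⁻¹) (x - y) * ‖g y‖ₑ)
      + ENNReal.ofReal (2 * bracket x ^ (-1 : ℝ)) * ∫⁻ y, ENNReal.ofReal (bracket y) * ‖g y‖ₑ := by
  have hK : Measurable ((Metric.ball (0 : E3) 1).indicator
      (fun z => ENNReal.ofReal (‖z‖ ^ 1)⁻¹)) :=
    (by fun_prop : Measurable fun z : E3 => ENNReal.ofReal (‖z‖ ^ 1)⁻¹).indicator measurableSet_ball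
  have hKx : Measurable fun y => (Metric.ball (0 : E3) 1).indicator
      (fun z => ENNReal.ofReal (‖z‖ ^ 1)⁻¹) (x - y) := hK.comp (measurable_const.sub measurable_id)
  rw [← lintegral_const_mul'' _ (by have := continuous_bracket; fun_prop),
    ← lintegral_add_left' (by
    exact hKx.aemeasurable.mul hg.enorm)]
  refine lintegral_mono fun y => ?_
  have h : ‖Phi k x y‖ₑ ≤ ENNReal.ofReal ‖x - y‖⁻¹ := by
    rw [← ofReal_norm]
    exact ENNReal.ofReal_le_ofReal (norm_Phi_le k x y)
  by_cases hxy : x - y ∈ Metric.ball (0 : E3) 1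
  · rw [Set.indicator_of_mem hxy, pow_one]
    exact le_add_right (by gcongr)
  · rw [Set.indicator_of_notMem hxy, zero_mul, zero_add, ← mul_assoc,
      ← ENNReal.ofReal_mul (by have := bracket_rpow_pos x (-1); positivity)]
    gcongr
    refine h.trans (ENNReal.ofReal_le_ofReal ?_)
    rw [mem_ball_zero_iff, not_lt] at hxy
    have hp := bracket_le_bracket_mul x y
    have hx := bracket_pos x
    have hy := bracket_pos y
    rw [Real.rpow_neg_one, inv_le_iff_one_le_mul₀ (by positivity)]
    have : 2 * (bracket x)⁻¹ * bracket y * ‖x - y‖ = (bracket y * (2 * ‖x - y‖)) / bracket x := by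
      field_simp
    rw [this, one_le_div hx]
    nlinarith

/-- The near part is bounded by Young's inequality, the weight being at most `1`. The far part
contributes `⟨x⟩^{-1-2ε} ⟨x⟩⁻² = ⟨x⟩^{-3-2ε}`, integrable on `ℝ³` for every `ε > 0`; this is why the
target exponent is independent of the source's. -/
lemma lintegral_absPotential_lt_top (k : ℝ) {g : E3 → ℂ} (hg : MemLp g 2)
    (hg1 : ∫⁻ y, ENNReal.ofReal (bracket y) * ‖g y‖ₑ < ∞) {ε : ℝ} (hε : 0 < ε) :
    ∫⁻ x, ENNReal.ofReal (bracket x ^ (2 * (-1 / 2 - ε))) * absPotential k g x ^ 2 < ∞ := by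
  set K : E3 → ℝ≥0∞ := (Metric.ball (0 : E3) 1).indicator (fun z => ENNReal.ofReal (‖z‖ ^ 1)⁻¹)
    with hKdef
  have hK : Measurable K :=
    (by fun_prop : Measurable fun z : E3 => ENNReal.ofReal (‖z‖ ^ 1)⁻¹).indicator measurableSet_ball
  have hgm := hg.1
  set M := ∫⁻ y, ENNReal.ofReal (bracket y) * ‖g y‖ₑ
  have hK1 : ∫⁻ z, K z < ∞ := by
    rw [hKdef, lintegral_indicator measurableSet_ball]
    exact (integrableOn_norm_inv_pow (p := 1) (by norm_num) 1).lintegral_lt_top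
  have hg2 : ∫⁻ y, ‖g y‖ₑ ^ 2 < ∞ := by
    have := (eLpNorm_lt_top_iff_lintegral_rpow_enorm_lt_top (by norm_num) (by norm_num)).1 hg.2
    simpa using this
  have hmeas : AEMeasurable fun p : E3 × E3 => K (p.1 - p.2) * ‖g p.2‖ₑ ^ 2 := by
    have : AEMeasurable (fun p : E3 × E3 => ‖g p.2‖ₑ) (volume.prod volume) :=
      hgm.enorm.comp_snd
    exact (hK.comp (measurable_fst.sub measurable_snd)).aemeasurable.mul (this.pow_const 2)
  have hbr : Measurable fun x : E3 => bracket x ^ (-1 : ℝ) := (continuous_bracket_rpow _).measurable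
  have hbr2 : Measurable fun x : E3 => bracket x ^ (2 * (-1 / 2 - ε)) :=
    (continuous_bracket_rpow _).measurable
  calc ∫⁻ x, ENNReal.ofReal (bracket x ^ (2 * (-1 / 2 - ε))) * absPotential k g x ^ 2
      ≤ ∫⁻ x, (2 * ((∫⁻ z, K z) * ∫⁻ y, K (x - y) * ‖g y‖ₑ ^ 2) +
          2 * (4 * M ^ 2 * ENNReal.ofReal (bracket x ^ (-3 - 2 * ε)))) := by
        refine lintegral_mono fun x => ?_
        have h1 : ∀ a b : ℝ≥0∞, (a + b) ^ 2 ≤ 2 * a ^ 2 + 2 * b ^ 2 := fun a b => by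
          have := ENNReal.rpow_add_le_mul_rpow_add_rpow a b (p := 2) (by norm_num)
          norm_num at this
          rwa [mul_add] at this
        have h2 : ENNReal.ofReal (bracket x ^ (2 * (-1 / 2 - ε))) ≤ 1 := by
          rw [ENNReal.ofReal_le_one]
          exact Real.rpow_le_one_of_one_le_of_nonpos (one_le_bracket x) (by linarith)
        have h3 := (pow_le_pow_left' (absPotential_le k hgm x) 2).trans (h1 _ _)
        refine (mul_le_mul_right h3 _).trans ?_
        rw [mul_add]
        refine add_le_add ?_ (le_of_eq ?_)
        · refine (mul_le_of_le_one_left' h2).trans ?_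
          gcongr
          have hKx : Measurable fun y => K (x - y) := hK.comp (measurable_const.sub measurable_id)
          refine (lintegral_mul_sq_le hKx.aemeasurable hgm.enorm).trans_eq ?_
          rw [lintegral_sub_left_eq_self K]
        · rw [mul_pow, ← ENNReal.ofReal_pow (by have := bracket_rpow_pos x (-1); positivity), mul_pow,
            ← Real.rpow_mul_natCast (bracket_pos x).le, ENNReal.ofReal_mul (by norm_num)]
          have : ENNReal.ofReal (bracket x ^ (-3 - 2 * ε)) =
              ENNReal.ofReal (bracket x ^ (2 * (-1 / 2 - ε)))
                * ENNReal.ofReal (bracket x ^ (-1 * ((2 : ℕ) : ℝ))) := by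
            rw [← ENNReal.ofReal_mul (bracket_rpow_pos x _).le, ← Real.rpow_add (bracket_pos x)]
            congr 2
            push_cast
            ring
          rw [this, show ENNReal.ofReal (2 ^ 2) = 4 by norm_num]
          change _ * (2 * (_ * M ^ 2)) = _
          ring
    _ = 2 * ((∫⁻ z, K z) * ((∫⁻ z, K z) * ∫⁻ y, ‖g y‖ₑ ^ 2)) +
          2 * (4 * M ^ 2 * ∫⁻ x : E3, ENNReal.ofReal (bracket x ^ (-3 - 2 * ε))) := by
        have hb3 : Measurable fun x : E3 => ENNReal.ofReal (bracket x ^ (-3 - 2 * ε)) :=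
          (continuous_bracket_rpow _).measurable.ennreal_ofReal
        rw [lintegral_add_right _ (by fun_prop)]
        congr 1
        · rw [lintegral_const_mul' _ _ (by norm_num), lintegral_const_mul' _ _ hK1.ne,
            lintegral_lintegral_swap hmeas]
          congr 2
          rw [← lintegral_const_mul' _ _ hK1.ne]
          refine lintegral_congr fun y => ?_
          rw [lintegral_mul_const'' _ (by fun_prop), lintegral_sub_right_eq_self K]
        · rw [lintegral_const_mul _ (by fun_prop), lintegral_const_mul _ hb3]
    _ < ∞ := by
        have h4 : ∫⁻ x : E3, ENNReal.ofReal (bracket x ^ (-3 - 2 * ε)) < ∞ :=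
          (integrable_bracket_rpow (by linarith)).lintegral_lt_top
        finiteness

/-! ### Jointly measurable versions of linear random fields -/

section RandomField

variable {Ω α H : Type*} [MeasurableSpace Ω] [MeasurableSpace α]
  [NormedAddCommGroup H] [InnerProductSpace ℂ H]

lemma lintegral_enorm_sq_Lp {β : Type*} [MeasurableSpace β] {ν : Measure β} (g : Lp ℂ 2 ν) :
    ∫⁻ x, ‖g x‖ₑ ^ 2 ∂ν = ‖g‖ₑ ^ 2 := by
  rw [Lp.enorm_def, eLpNorm_eq_lintegral_rpow_enorm_toReal (by norm_num) (by norm_num),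
    ← ENNReal.rpow_natCast, ← ENNReal.rpow_mul]
  norm_num

lemma memLp_two_iff_lintegral {β : Type*} [MeasurableSpace β] {ν : Measure β} {g : β → ℂ} :
    MemLp g 2 ν ↔ AEStronglyMeasurable g ν ∧ ∫⁻ x, ‖g x‖ₑ ^ 2 ∂ν < ∞ := by
  rw [MemLp, eLpNorm_lt_top_iff_lintegral_rpow_enorm_lt_top (by norm_num) (by norm_num)]
  simp

/-- A finite combination of elements of the range of a bounded operator into `L²(P)`. -/
lemma lintegral_sum_mul_le {P : Measure Ω} {ι : Type*} (X : H →L[ℂ] Lp ℂ 2 P) (e : ι → H)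
    (he : Orthonormal ℂ e) (s : Finset ι) (h : H) :
    ∫⁻ ω, ‖∑ j ∈ s, inner ℂ (e j) h * X (e j) ω‖ₑ ^ 2 ∂P
      ≤ ‖X‖ₑ ^ 2 * ENNReal.ofReal (∑ j ∈ s, ‖inner ℂ (e j) h‖ ^ 2) := by
  have h1 : (X (∑ j ∈ s, inner ℂ (e j) h • e j) : Ω → ℂ)
      =ᵐ[P] fun ω => ∑ j ∈ s, inner ℂ (e j) h * X (e j) ω := by
    rw [map_sum]
    have h2 : ∀ᵐ ω ∂P, ∀ j ∈ s, (X (inner ℂ (e j) h • e j)) ω = inner ℂ (e j) h * X (e j) ω := by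
      refine (Finset.eventually_all s).2 fun j _ => ?_
      rw [map_smul]
      filter_upwards [Lp.coeFn_smul (inner ℂ (e j) h) (X (e j))] with ω hω
      simp [hω]
    filter_upwards [Lp.coeFn_finsetSum s (fun j => X (inner ℂ (e j) h • e j)), h2] with ω hω h3
    rw [hω, Finset.sum_apply]
    exact Finset.sum_congr rfl h3
  have h4 : ‖∑ j ∈ s, inner ℂ (e j) h • e j‖ ^ 2 = ∑ j ∈ s, ‖inner ℂ (e j) h‖ ^ 2 := by
    have := he.inner_sum (fun j => inner ℂ (e j) h) (fun j => inner ℂ (e j) h) s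
    rw [inner_self_eq_norm_sq_to_K] at this
    have h5 : ((‖∑ j ∈ s, inner ℂ (e j) h • e j‖ ^ 2 : ℝ) : ℂ)
        = ((∑ j ∈ s, ‖inner ℂ (e j) h‖ ^ 2 : ℝ) : ℂ) := by
      push_cast
      rw [← Complex.coe_algebraMap] at *
      refine this.trans (Finset.sum_congr rfl fun j _ => ?_)
      rw [mul_comm, Complex.mul_conj, Complex.normSq_eq_norm_sq]
      simp
    exact_mod_cast h5
  calc ∫⁻ ω, ‖∑ j ∈ s, inner ℂ (e j) h * X (e j) ω‖ₑ ^ 2 ∂P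
      = ‖X (∑ j ∈ s, inner ℂ (e j) h • e j)‖ₑ ^ 2 := by
        rw [← lintegral_enorm_sq_Lp]
        refine lintegral_congr_ae ?_
        filter_upwards [h1] with ω hω
        rw [hω]
    _ ≤ (‖X‖ₑ * ‖∑ j ∈ s, inner ℂ (e j) h • e j‖ₑ) ^ 2 := by
        gcongr
        exact X.le_opENorm _
    _ = _ := by
        rw [mul_pow, ← h4, ← ofReal_norm (∑ j ∈ s, inner ℂ (e j) h • e j),
          ENNReal.ofReal_pow (norm_nonneg _)]

/-- A bounded operator `X` from a Hilbert space to `L²(P)`, composed with a weakly measurable family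
`κ`, has a jointly measurable version `F`; its second moments are bounded by those of `κ`, and
integration against a test function commutes with `X`. -/
theorem exists_measurable_version [CompleteSpace H] (P : Measure Ω) [IsProbabilityMeasure P]
    (ν : Measure α) [SigmaFinite ν] (X : H →L[ℂ] Lp ℂ 2 P) (κ : α → H)
    (hκ : ∀ h, Measurable fun x => inner ℂ h (κ x)) (β : α → ℝ)
    (hκβ : ∀ x, ‖κ x‖ ≤ β x) (w : α → ℝ) (hwm : Measurable w) (hw : ∀ x, 0 < w x)
    (hwβ : ∫⁻ x, ENNReal.ofReal (w x ^ 2 * β x ^ 2) ∂ν < ∞) :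
    ∃ F : Ω → α → ℂ, Measurable (Function.uncurry F) ∧
      (∀ v : α → ℝ≥0∞, Measurable v → (∀ x, v x ≠ ∞) →
        ∫⁻ ω, ∫⁻ x, v x * ‖F ω x‖ₑ ^ 2 ∂ν ∂P ≤ ‖X‖ₑ ^ 2 * ∫⁻ x, v x * ENNReal.ofReal (β x ^ 2) ∂ν) ∧
      ∀ (φ : α → ℂ), Measurable φ → ∫⁻ x, ENNReal.ofReal ((w x)⁻¹ ^ 2) * ‖φ x‖ₑ ^ 2 ∂ν < ∞ →
        ∀ Kφ : H, (∀ h, inner ℂ h Kφ = ∫ x, φ x * inner ℂ h (κ x) ∂ν) →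
        ∀ᵐ ω ∂P, ∫ x, F ω x * φ x ∂ν = X Kφ ω := by
  obtain ⟨S, b, -⟩ := exists_hilbertBasis ℂ H
  have hβ : ∀ x, 0 ≤ β x := fun x => (norm_nonneg _).trans (hκβ x)
  -- The version is the sum over `j` of `⟨b_j, κ(x)⟩ · X b_j(ω)`, formally `X(κ(x))(ω)`. Each term
  -- is a product of a function of `x` and one of `ω`, hence jointly measurable; the factor `w` in
  -- `G` makes the series converge in `L²(P ⊗ ν)`.
  set a : S → α → ℂ := fun j x => inner ℂ (b j) (κ x)
  have ham : ∀ j, Measurable (a j) := fun j => hκ _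
  set Y : S → Ω → ℂ := fun j => X (b j)
  have hYm : ∀ j, Measurable (Y j) := fun j => (Lp.stronglyMeasurable _).measurable
  set G : S → Ω × α → ℂ := fun j p => (w p.2 : ℂ) * (a j p.2 * Y j p.1)
  have hGm : ∀ j, Measurable (G j) := fun j => by
    have := ham j; have := hYm j
    fun_prop
  -- the basic estimate, for an arbitrary weight
  have key : ∀ (s : Finset S) (v : α → ℝ≥0∞), Measurable v →
      ∫⁻ p, v p.2 * ‖∑ j ∈ s, a j p.2 * Y j p.1‖ₑ ^ 2 ∂(P.prod ν)
        ≤ ‖X‖ₑ ^ 2 * ∫⁻ x, v x * ENNReal.ofReal (∑ j ∈ s, ‖a j x‖ ^ 2) ∂ν := by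
    intro s v hv
    rw [lintegral_prod_symm' _ (by fun_prop)]
    have hm : Measurable fun x => v x * ENNReal.ofReal (∑ j ∈ s, ‖a j x‖ ^ 2) := by fun_prop
    rw [← lintegral_const_mul _ hm]
    refine lintegral_mono fun x => ?_
    simp only
    rw [lintegral_const_mul _ (by fun_prop), mul_left_comm]
    gcongr
    exact lintegral_sum_mul_le X b b.orthonormal s (κ x)
  have bessel : ∀ (s : Finset S) x, ∑ j ∈ s, ‖a j x‖ ^ 2 ≤ β x ^ 2 := fun s x =>
    (b.orthonormal.sum_inner_products_le (κ x)).trans (pow_le_pow_left₀ (norm_nonneg _) (hκβ x) 2)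
  have sumG : ∀ (s : Finset S) (p : Ω × α), ∑ j ∈ s, G j p = (w p.2 : ℂ) * ∑ j ∈ s, a j p.2 * Y j p.1 :=
    fun s p => by rw [Finset.mul_sum]
  have enG : ∀ (s : Finset S) (p : Ω × α), ‖∑ j ∈ s, G j p‖ₑ ^ 2
      = ENNReal.ofReal (w p.2 ^ 2) * ‖∑ j ∈ s, a j p.2 * Y j p.1‖ₑ ^ 2 := fun s p => by
    rw [sumG, enorm_mul, mul_pow, ← ofReal_norm (w p.2 : ℂ), Complex.norm_real,
      Real.norm_of_nonneg (hw _).le, ENNReal.ofReal_pow (hw _).le]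
  set A : S → ℝ≥0∞ := fun j => ∫⁻ x, ENNReal.ofReal (w x ^ 2) * ENNReal.ofReal (‖a j x‖ ^ 2) ∂ν
  have hA : ∀ s : Finset S, ∑ j ∈ s, A j
      = ∫⁻ x, ENNReal.ofReal (w x ^ 2) * ENNReal.ofReal (∑ j ∈ s, ‖a j x‖ ^ 2) ∂ν := by
    intro s
    rw [← lintegral_finsetSum _ (fun j _ => by fun_prop)]
    refine lintegral_congr fun x => ?_
    rw [← Finset.mul_sum, ENNReal.ofReal_sum_of_nonneg fun j _ => by positivity]
  have hA' : ∀ s : Finset S, ∑ j ∈ s, A j ≤ ∫⁻ x, ENNReal.ofReal (w x ^ 2 * β x ^ 2) ∂ν := by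
    intro s
    rw [hA]
    refine lintegral_mono fun x => ?_
    rw [ENNReal.ofReal_mul (by positivity)]
    gcongr
    exact bessel s x
  have hAsum : ∑' j, A j ≠ ∞ :=
    ((ENNReal.summable.tsum_le_of_sum_le hA').trans_lt hwβ).ne
  have estG : ∀ s : Finset S, ∫⁻ p, ‖∑ j ∈ s, G j p‖ₑ ^ 2 ∂(P.prod ν) ≤ ‖X‖ₑ ^ 2 * ∑ j ∈ s, A j := by
    intro s
    simp only [enG]
    rw [hA]
    exact key s (fun x => ENNReal.ofReal (w x ^ 2)) (by fun_prop)
  have hXtop : ‖X‖ₑ ^ 2 < ∞ := by finiteness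
  have memG : ∀ j, MemLp (G j) 2 (P.prod ν) := fun j => by
    refine memLp_two_iff_lintegral.2 ⟨(hGm j).aestronglyMeasurable, ?_⟩
    have := estG {j}
    simp only [Finset.sum_singleton] at this
    exact this.trans_lt (ENNReal.mul_lt_top hXtop (ENNReal.lt_top_of_tsum_ne_top hAsum j))
  set g : S → Lp ℂ 2 (P.prod ν) := fun j => (memG j).toLp (G j)
  have coeg : ∀ s : Finset S, (∑ j ∈ s, g j : Lp ℂ 2 (P.prod ν)) =ᵐ[P.prod ν]
      fun p => ∑ j ∈ s, G j p := by
    intro s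
    have h2 : ∀ᵐ p ∂(P.prod ν), ∀ j ∈ s, g j p = G j p :=
      (Finset.eventually_all s).2 fun j _ => (memG j).coeFn_toLp
    filter_upwards [Lp.coeFn_finsetSum s g, h2] with p hp h3
    rw [hp, Finset.sum_apply]
    exact Finset.sum_congr rfl h3
  have normg : ∀ s : Finset S, ‖∑ j ∈ s, g j‖ₑ ^ 2 ≤ ‖X‖ₑ ^ 2 * ∑ j ∈ s, A j := by
    intro s
    rw [← lintegral_enorm_sq_Lp]
    refine le_trans (le_of_eq (lintegral_congr_ae ?_)) (estG s)
    filter_upwards [coeg s] with p hp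
    rw [hp]
  -- The basis need not be countable and the `g j` need not be orthogonal, as `X` is arbitrary. The
  -- Cauchy criterion over finite sets works because block norms are controlled by the tails of the
  -- convergent sum of `A`.
  have hsummable : Summable g := by
    rw [summable_iff_vanishing_norm]
    intro ε hε
    have hA2 : Summable fun j => (A j).toReal := ENNReal.summable_toReal hAsum
    obtain ⟨s, hs⟩ := (summable_iff_vanishing_norm.1 hA2) (ε ^ 2 / (‖X‖ ^ 2 + 1)) (by positivity)
    refine ⟨s, fun t ht => ?_⟩
    have h1 := hs t ht
    rw [Real.norm_of_nonneg (Finset.sum_nonneg fun j _ => ENNReal.toReal_nonneg)] at h1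
    have h2 : ‖∑ j ∈ t, g j‖ ^ 2 ≤ ‖X‖ ^ 2 * ∑ j ∈ t, (A j).toReal := by
      have := ENNReal.toReal_mono ?_ (normg t)
      · rw [ENNReal.toReal_mul, ENNReal.toReal_pow, ENNReal.toReal_pow, toReal_enorm, toReal_enorm,
          ENNReal.toReal_sum fun j _ => (ENNReal.lt_top_of_tsum_ne_top hAsum j).ne] at this
        exact this
      · exact (ENNReal.mul_lt_top hXtop (ENNReal.sum_lt_top.2 fun j _ =>
          ENNReal.lt_top_of_tsum_ne_top hAsum j)).ne
    rw [lt_div_iff₀ (by positivity)] at h1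
    refine lt_of_pow_lt_pow_left₀ 2 hε.le (h2.trans_lt ?_)
    have : 0 ≤ ∑ j ∈ t, (A j).toReal := Finset.sum_nonneg fun j _ => ENNReal.toReal_nonneg
    nlinarith
  obtain ⟨f, hf⟩ := hsummable
  have hfm : Measurable (f : Ω × α → ℂ) := (Lp.stronglyMeasurable f).measurable
  have hw' : ∀ x, (w x : ℂ) ≠ 0 := fun x => by exact_mod_cast (hw x).ne'
  refine ⟨fun ω x => (w x : ℂ)⁻¹ * f (ω, x), by
    change Measurable fun p : Ω × α => (w p.2 : ℂ)⁻¹ * f (p.1, p.2)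
    fun_prop, ?_, ?_⟩
  · intro v hv hvt
    -- Convergence along finite sets is replaced by a sequence, so that a subsequence converges
    -- almost everywhere and Fatou's lemma applies.
    obtain ⟨s, hs⟩ : ∃ s : ℕ → Finset S,
        Filter.Tendsto (fun n => ∑ j ∈ s n, g j) Filter.atTop (𝓝 f) := by
      have : ∀ n : ℕ, ∃ s : Finset S, dist (∑ j ∈ s, g j) f < 1 / (n + 1) := fun n =>
        ((Metric.tendsto_nhds.1 hf) _ (by positivity)).exists
      choose s hs using this
      exact ⟨s, tendsto_iff_dist_tendsto_zero.2 (squeeze_zero (fun _ => dist_nonneg)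
        (fun n => (hs n).le) tendsto_one_div_add_atTop_nhds_zero_nat)⟩
    obtain ⟨n, -, hn⟩ := (tendstoInMeasure_of_tendsto_Lp hs).exists_seq_tendsto_ae
    have hcoe : ∀ᵐ p ∂(P.prod ν), ∀ i, (∑ j ∈ s (n i), g j : Lp ℂ 2 (P.prod ν)) p
        = ∑ j ∈ s (n i), G j p := ae_all_iff.2 fun i => coeg _
    have hlim : ∀ᵐ p ∂(P.prod ν), v p.2 * ‖(w p.2 : ℂ)⁻¹ * f p‖ₑ ^ 2 ≤
        Filter.liminf (fun i => v p.2 * ‖∑ j ∈ s (n i), a j p.2 * Y j p.1‖ₑ ^ 2) Filter.atTop := by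
      filter_upwards [hn, hcoe] with p hp hp2
      have h1 : Filter.Tendsto (fun i => ∑ j ∈ s (n i), a j p.2 * Y j p.1) Filter.atTop
          (𝓝 ((w p.2 : ℂ)⁻¹ * f p)) := by
        refine (hp.const_mul ((w p.2 : ℂ)⁻¹)).congr fun i => ?_
        rw [hp2, sumG, inv_mul_cancel_left₀ (hw' _)]
      have h2 : Filter.Tendsto (fun i => ‖∑ j ∈ s (n i), a j p.2 * Y j p.1‖ₑ ^ 2) Filter.atTop
          (𝓝 (‖(w p.2 : ℂ)⁻¹ * f p‖ₑ ^ 2)) := (ENNReal.continuous_pow 2).continuousAt.tendsto.comp h1.enorm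
      rw [(ENNReal.Tendsto.const_mul h2 (Or.inr (hvt p.2))).liminf_eq]
    calc ∫⁻ ω, ∫⁻ x, v x * ‖(w x : ℂ)⁻¹ * f (ω, x)‖ₑ ^ 2 ∂ν ∂P
        = ∫⁻ p, v p.2 * ‖(w p.2 : ℂ)⁻¹ * f p‖ₑ ^ 2 ∂(P.prod ν) := by
          rw [lintegral_prod _ (by fun_prop)]
      _ ≤ ∫⁻ p, Filter.liminf (fun i => v p.2 * ‖∑ j ∈ s (n i), a j p.2 * Y j p.1‖ₑ ^ 2)
            Filter.atTop ∂(P.prod ν) := lintegral_mono_ae hlim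
      _ ≤ Filter.liminf (fun i => ∫⁻ p, v p.2 * ‖∑ j ∈ s (n i), a j p.2 * Y j p.1‖ₑ ^ 2 ∂(P.prod ν))
            Filter.atTop := lintegral_liminf_le fun i => by fun_prop
      _ ≤ _ := by
          refine Filter.liminf_le_of_le (by isBoundedDefault) fun c hc => ?_
          obtain ⟨i, hi⟩ := hc.exists
          refine hi.trans ((key _ v hv).trans ?_)
          gcongr with x
          exact bessel _ x
  · intro φ hφ hφ2 Kφ hK
    -- The conjugate is placed here so that pairing with `θ` in `L²` gives `∫ F φ` without
    -- conjugates; the hypothesis on `φ` says exactly that `θ` is square integrable.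
    set θ : Ω × α → ℂ := fun p => (starRingEnd ℂ) ((w p.2 : ℂ)⁻¹ * φ p.2)
    have hθm : Measurable θ := by fun_prop
    have hθ : MemLp θ 2 (P.prod ν) := by
      refine memLp_two_iff_lintegral.2 ⟨hθm.aestronglyMeasurable, ?_⟩
      rw [lintegral_prod _ (by fun_prop)]
      have e : ∀ x, ‖(starRingEnd ℂ) ((w x : ℂ)⁻¹ * φ x)‖ₑ ^ 2
          = ENNReal.ofReal ((w x)⁻¹ ^ 2) * ‖φ x‖ₑ ^ 2 := fun x => by
        rw [RCLike.enorm_conj, enorm_mul, mul_pow, ← ofReal_norm (w x : ℂ)⁻¹, norm_inv, Complex.norm_real,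
          Real.norm_of_nonneg (hw x).le, ENNReal.ofReal_pow (inv_nonneg.2 (hw x).le)]
      simp only [θ, e, lintegral_const, measure_univ, mul_one]
      exact hφ2
    have hint : Integrable (fun p : Ω × α => (w p.2 : ℂ)⁻¹ * f p * φ p.2) (P.prod ν) := by
      refine (L2.integrable_inner (𝕜 := ℂ) (hθ.toLp θ) f).congr ?_
      filter_upwards [hθ.coeFn_toLp] with p hp
      rw [hp]
      simp only [θ, RCLike.inner_apply, RingHomCompTriple.comp_apply, RingHom.id_apply]
      ring
    have hint1 : Integrable (fun ω => ∫ x, (w x : ℂ)⁻¹ * f (ω, x) * φ x ∂ν) P := hint.integral_prod_left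
    have hXint : Integrable (X Kφ) P := (Lp.memLp (X Kφ)).integrable (by norm_num)
    -- Integrating over `s` turns both sides into continuous linear functionals, of `f` and of `Kφ`.
    -- Expanded along the basis they agree term by term, since the coefficient `⟨b_j, Kφ⟩` is `∫ φ
    -- ⟨b_j, κ⟩`.
    refine Integrable.ae_eq_of_forall_setIntegral_eq _ _ hint1 hXint fun s hs _ => ?_
    have hθs : MemLp (Set.indicator (s ×ˢ Set.univ) θ) 2 (P.prod ν) :=
      hθ.indicator (hs.prod MeasurableSet.univ)
    have e1 : ∀ h : Lp ℂ 2 (P.prod ν), inner ℂ (hθs.toLp _) h =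
        ∫ p, s.indicator (fun _ => (1 : ℂ)) p.1 * ((w p.2 : ℂ)⁻¹ * h p * φ p.2) ∂(P.prod ν) := by
      intro h
      rw [L2.inner_def]
      refine integral_congr_ae ?_
      filter_upwards [hθs.coeFn_toLp] with p hp
      rw [hp]
      by_cases hps : p.1 ∈ s
      · simp [hps, θ]
        ring
      · simp [hps]
    have h1 : HasSum (fun j => inner ℂ (hθs.toLp _) (g j)) (inner ℂ (hθs.toLp _) f) :=
      hf.mapL (innerSL ℂ (hθs.toLp _))
    have h2 : HasSum (fun j => inner ℂ (indicatorConstLp 2 hs (measure_ne_top P s) (1 : ℂ))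
        (X (b.repr Kφ j • b j))) (inner ℂ (indicatorConstLp 2 hs (measure_ne_top P s) (1 : ℂ)) (X Kφ)) :=
      ((b.hasSum_repr Kφ).mapL X).mapL (innerSL ℂ _)
    rw [L2.inner_indicatorConstLp_one] at h2
    have e2 : inner ℂ (hθs.toLp _) f = ∫ ω in s, ∫ x, (w x : ℂ)⁻¹ * f (ω, x) * φ x ∂ν ∂P := by
      rw [e1, integral_prod, ← integral_indicator hs]
      · refine integral_congr_ae (Filter.Eventually.of_forall fun ω => ?_)
        by_cases hω : ω ∈ s <;> simp [hω]
      · refine (hint.indicator (hs.prod MeasurableSet.univ)).congr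
          (Filter.Eventually.of_forall fun p => ?_)
        by_cases hps : p.1 ∈ s <;> simp [hps]
    have e3 : ∀ j, inner ℂ (hθs.toLp _) (g j) =
        inner ℂ (indicatorConstLp 2 hs (measure_ne_top P s) (1 : ℂ)) (X (b.repr Kφ j • b j)) := by
      intro j
      rw [e1, map_smul, inner_smul_right, L2.inner_indicatorConstLp_one, b.repr_apply_apply, hK,
        ← integral_indicator hs, mul_comm, ← integral_prod_mul]
      refine integral_congr_ae ?_
      filter_upwards [(memG j).coeFn_toLp] with p hp
      rw [hp]
      have := hw' p.2
      by_cases hps : p.1 ∈ s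
      · simp only [hps, Set.indicator_of_mem, G, one_mul, Y, a]
        field_simp
      · simp [hps]
    rw [← e2]
    simp only [e3] at h1
    exact h1.unique h2

end RandomField

/-! ### `L²` bound for pseudodifferential operators of non-positive order -/

section PseudoOp

open FourierTransform

/-- The substitution `ξ = 2πη` passes to the Fourier transform with phase `e^{-2πi y·η}`; its
Jacobian cancels the factor `(2π)^{-3}`. -/
lemma pseudoOp_eq_integral_fourier (c : E3 → E3 → ℂ) (φ : 𝓢(E3, ℂ)) (x : E3) :
    pseudoOp c φ x = ∫ η : E3, Complex.exp ((2 * Real.pi * (inner ℝ x η : ℝ) : ℝ) * Complex.I) *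
      c x ((2 * Real.pi) • η) * 𝓕 φ η := by
  have h := Measure.integral_comp_smul (volume : Measure E3) (fun ξ : E3 =>
    Complex.exp (Complex.I * (inner ℝ x ξ : ℝ)) * c x ξ *
      ∫ y : E3, Complex.exp (-Complex.I * (inner ℝ y ξ : ℝ)) * φ y) (2 * Real.pi)
  rw [finrank_E3, abs_of_nonneg (by positivity)] at h
  have e : pseudoOp c φ x = ((2 * Real.pi) ^ 3)⁻¹ • ∫ ξ : E3,
      Complex.exp (Complex.I * (inner ℝ x ξ : ℝ)) * c x ξ *
      ∫ y : E3, Complex.exp (-Complex.I * (inner ℝ y ξ : ℝ)) * φ y := by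
    rw [pseudoOp, Complex.real_smul, one_div]
  rw [e, ← h]
  refine integral_congr_ae (Filter.Eventually.of_forall fun η => ?_)
  simp only [SchwartzMap.fourier_coe, Real.fourier_eq', inner_smul_right, smul_eq_mul]
  congr 2
  · congr 1
    push_cast
    ring
  · ext1 y
    congr 2
    push_cast
    ring

variable {s : ℝ} {c : E3 → E3 → ℂ}

lemma IsSymbol.contDiff_left (hc : IsSymbol s c) (ξ : E3) :
    ContDiff ℝ (⊤ : ℕ∞) fun x => c x ξ :=
  hc.1.comp (contDiff_id.prodMk contDiff_const)

/-- For order `s ≤ 0` the factor `⟨ξ⟩^s` is at most `1`, so `x`-derivatives are bounded uniformly in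
`ξ`. This uniformity is all that the `L²` bound takes from the symbol estimates. -/
lemma IsSymbol.norm_iteratedFDeriv_le (hc : IsSymbol s c) (hs : s ≤ 0) (n : ℕ) :
    ∃ C : ℝ, ∀ x ξ : E3, ‖iteratedFDeriv ℝ n (fun x => c x ξ) x‖ ≤ C := by
  obtain ⟨C, hC⟩ := hc.2 n 0
  refine ⟨C, fun x ξ => ?_⟩
  have e : mixedDeriv n 0 c x ξ = iteratedFDeriv ℝ n
      ((continuousMultilinearCurryFin0 ℝ E3 ℂ).symm ∘ fun x => c x ξ) x := rfl
  have h := hC x ξ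
  rw [e, LinearIsometryEquiv.norm_iteratedFDeriv_comp_left] at h
  have hpos := bracket_rpow_pos ξ (s - (0 : ℕ))
  have hC0 : 0 ≤ C := by
    have := (norm_nonneg _).trans h
    by_contra hC0
    nlinarith
  refine h.trans (mul_le_of_le_one_right hC0 ?_)
  exact Real.rpow_le_one_of_one_le_of_nonpos (one_le_bracket ξ) (by simpa using hs)

/-- Decay in the first variable of the Fourier transform of a localized symbol. -/
lemma IsSymbol.exists_norm_fourier_le (hc : IsSymbol s c) (hs : s ≤ 0) {χ : E3 → ℂ}
    (hχ : ContDiff ℝ (⊤ : ℕ∞) χ) (hχc : HasCompactSupport χ) :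
    ∃ C : ℝ, 0 ≤ C ∧ ∀ ξ ζ : E3, ‖𝓕 (fun x => χ x * c x ξ) ζ‖ ≤ C * (1 + ‖ζ‖) ^ (-4 : ℝ) := by
  choose B hB using fun n => hc.norm_iteratedFDeriv_le hs n
  have hB0 : ∀ n, 0 ≤ B n := fun n => (norm_nonneg _).trans (hB n 0 0)
  have hu : ∀ ξ, ContDiff ℝ (⊤ : ℕ∞) fun x => χ x * c x ξ := fun ξ => hχ.mul (hc.contDiff_left ξ)
  have huc : ∀ ξ, HasCompactSupport fun x => χ x * c x ξ := fun ξ => hχc.mul_right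
  have hint : ∀ n ξ, Integrable (fun x => ‖iteratedFDeriv ℝ n (fun x => χ x * c x ξ) x‖) :=
    fun n ξ => ((hu ξ).continuous_iteratedFDeriv (by exact_mod_cast le_top)).norm.integrable_of_hasCompactSupport
      ((huc ξ).iteratedFDeriv n).norm
  have hχi : ∀ n, Integrable (fun x => ‖iteratedFDeriv ℝ n χ x‖) := fun n =>
    (hχ.continuous_iteratedFDeriv (by exact_mod_cast le_top)).norm.integrable_of_hasCompactSupport
      (hχc.iteratedFDeriv n).norm
  have hM : ∀ n, ∃ M : ℝ, 0 ≤ M ∧ ∀ ξ, ∫ x, ‖iteratedFDeriv ℝ n (fun x => χ x * c x ξ) x‖ ≤ M := by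
    intro n
    refine ⟨∫ x, ∑ i ∈ Finset.range (n + 1), (n.choose i : ℝ) * ‖iteratedFDeriv ℝ i χ x‖ * B (n - i),
      integral_nonneg fun x => Finset.sum_nonneg fun i _ => by have := hB0 (n - i); positivity,
      fun ξ => ?_⟩
    refine integral_mono (hint n ξ) ?_ fun x => ?_
    · exact integrable_finsetSum _ fun i _ => ((hχi i).const_mul _).mul_const _
    · refine (norm_iteratedFDeriv_mul_le hχ (hc.contDiff_left ξ) x (by exact_mod_cast le_top)).trans ?_
      gcongr with i
      exact hB _ _ _
  choose M hM0 hM using hM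
  set S : ℕ → ℝ := fun n => 2 ^ n * ∑ p ∈ Finset.range (n + 1), M p
  have hS0 : ∀ n, 0 ≤ S n := fun n => by
    have := Finset.sum_nonneg fun p (_ : p ∈ Finset.range (n + 1)) => hM0 p
    positivity
  have hF : ∀ n ξ ζ, ‖ζ‖ ^ n * ‖𝓕 (fun x => χ x * c x ξ) ζ‖ ≤ S n := by
    intro n ξ ζ
    have h := Real.pow_mul_norm_iteratedFDeriv_fourier_le (K := 0) (N := ⊤)
      (f := fun x => χ x * c x ξ) (by exact_mod_cast hu ξ) (fun k n hk _ => by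
        have : k = 0 := by simpa using hk
        subst this
        simpa using hint n ξ) (k := 0) (n := n) (by simp) (by simp) ζ
    simp only [norm_iteratedFDeriv_zero] at h
    refine h.trans ?_
    simp only [pow_zero, Nat.cast_zero, mul_zero, zero_add, one_mul, Finset.range_one,
      Finset.singleton_product, Finset.sum_map, Function.Embedding.coeFn_mk, S]
    gcongr
    exact hM _ _
  -- Orders `0` and `4` combine through `(1+t)⁴ ≤ 8(1+t⁴)`; the exponent `4` exceeds the dimension,
  -- so the bound is integrable in `ζ`.
  refine ⟨8 * (S 0 + S 4), by have := hS0 0; have := hS0 4; positivity, fun ξ ζ => ?_⟩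
  have h0 := hF 0 ξ ζ
  have h4 := hF 4 ξ ζ
  rw [Real.rpow_neg (by positivity), ← div_eq_mul_inv, le_div_iff₀ (by positivity)]
  norm_num
  have h5 : (1 + ‖ζ‖) ^ 4 ≤ 8 * (1 + ‖ζ‖ ^ 4) := by
    nlinarith [sq_nonneg (‖ζ‖ - 1), sq_nonneg (‖ζ‖ ^ 2 - 1), sq_nonneg (‖ζ‖ ^ 2 - ‖ζ‖), norm_nonneg ζ,
      sq_nonneg (‖ζ‖ + 1), mul_nonneg (norm_nonneg ζ) (sq_nonneg (‖ζ‖ - 1))]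
  nlinarith [norm_nonneg (𝓕 (fun x => χ x * c x ξ) ζ)]

lemma fourier_exp_mul (ψ : E3 → ℂ) (η ζ : E3) :
    𝓕 (fun x => Complex.exp ((2 * Real.pi * (inner ℝ x η : ℝ) : ℝ) * Complex.I) * ψ x) ζ
      = 𝓕 ψ (ζ - η) := by
  rw [Real.fourier_eq', Real.fourier_eq']
  refine integral_congr_ae (Filter.Eventually.of_forall fun x => ?_)
  simp only [smul_eq_mul, ← mul_assoc, ← Complex.exp_add, inner_sub_right]
  congr 2
  push_cast
  ring

/-- Write `u` as the Fourier transform of `𝓕⁻ u` and move the transform to the other factor; there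
the exponential becomes the translation `ζ ↦ ζ - η` of `𝓕 ψ`. -/
lemma enorm_integral_exp_mul_le {C : ℝ} {u : E3 → ℂ} (hu : ContDiff ℝ (⊤ : ℕ∞) u)
    (huc : HasCompactSupport u) (hC : ∀ ζ, ‖𝓕 u ζ‖ ≤ C * (1 + ‖ζ‖) ^ (-4 : ℝ)) (ψ : 𝓢(E3, ℂ))
    (η : E3) :
    ‖∫ x, Complex.exp ((2 * Real.pi * (inner ℝ x η : ℝ) : ℝ) * Complex.I) * (u x * ψ x)‖ₑ ≤
      ∫⁻ ζ, ENNReal.ofReal (C * (1 + ‖ζ‖) ^ (-4 : ℝ)) * ‖𝓕 ψ (ζ - η)‖ₑ := by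
  set U : 𝓢(E3, ℂ) := huc.toSchwartzMap hu
  have hU : ∀ x, U x = u x := fun x => rfl
  have hψ : Integrable fun x => Complex.exp ((2 * Real.pi * (inner ℝ x η : ℝ) : ℝ) * Complex.I) * ψ x := by
    refine ψ.integrable.bdd_mul (c := 1) (by fun_prop) (Filter.Eventually.of_forall fun x => ?_)
    rw [Complex.norm_exp_ofReal_mul_I]
  have h := VectorFourier.integral_fourierIntegral_smul_eq_flip (L := innerₗ E3) (μ := volume)
    (ν := volume) Real.continuous_fourierChar continuous_inner (𝓕⁻ U).integrable hψ
  have h2 : ∫ x, Complex.exp ((2 * Real.pi * (inner ℝ x η : ℝ) : ℝ) * Complex.I) * (u x * ψ x)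
      = ∫ ζ, 𝓕⁻ U ζ * 𝓕 ψ (ζ - η) := by
    have hl : ∀ x, VectorFourier.fourierIntegral Real.fourierChar volume (innerₗ E3)
        (⇑(𝓕⁻ U : 𝓢(E3, ℂ))) x = u x := by
      intro x
      have : (𝓕 (𝓕⁻ U) : 𝓢(E3, ℂ)) x = U x := by rw [FourierTransform.fourier_fourierInv_eq]
      exact this
    have hr : ∀ ζ, VectorFourier.fourierIntegral Real.fourierChar volume (innerₗ E3).flip
        (fun x => Complex.exp ((2 * Real.pi * (inner ℝ x η : ℝ) : ℝ) * Complex.I) * ψ x) ζ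
        = 𝓕 ψ (ζ - η) := by
      intro ζ
      rw [flip_innerₗ]
      exact fourier_exp_mul ψ η ζ
    simp only [hl, hr, smul_eq_mul] at h
    rw [← h]
    refine integral_congr_ae (Filter.Eventually.of_forall fun x => ?_)
    ring
  rw [h2]
  refine (enorm_integral_le_lintegral_enorm _).trans (lintegral_mono fun ζ => ?_)
  rw [enorm_mul]
  gcongr
  rw [← ofReal_norm]
  refine ENNReal.ofReal_le_ofReal ?_
  have : 𝓕⁻ U ζ = 𝓕 u (-ζ) := by
    rw [SchwartzMap.fourierInv_coe, Real.fourierInv_eq_fourier_neg]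
    rfl
  rw [this]
  simpa using hC (-ζ)

lemma lintegral_enorm_sq_fourier (φ : 𝓢(E3, ℂ)) :
    ∫⁻ x, ‖𝓕 φ x‖ₑ ^ 2 = ‖φ.toLp 2‖ₑ ^ 2 := by
  have h : ‖(𝓕 φ).toLp 2‖ = ‖φ.toLp 2‖ := by
    rw [← SchwartzMap.toLp_fourier_eq, Lp.norm_fourier_eq]
  rw [← ofReal_norm, ← h, ofReal_norm, ← lintegral_enorm_sq_Lp]
  refine lintegral_congr_ae ?_
  filter_upwards [SchwartzMap.coeFn_toLp (𝓕 φ) 2] with x hx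
  rw [hx]

/-- A pseudodifferential operator of non-positive order, localized by a cutoff, is bounded on `L²`. -/
theorem IsSymbol.exists_norm_integral_pseudoOp_le (hc : IsSymbol s c) (hs : s ≤ 0) {χ : E3 → ℂ}
    (hχ : ContDiff ℝ (⊤ : ℕ∞) χ) (hχc : HasCompactSupport χ) :
    ∃ C : ℝ, 0 ≤ C ∧ ∀ φ ψ : 𝓢(E3, ℂ), ‖∫ x, pseudoOp c φ x * (χ x * ψ x)‖ ≤
      C * (‖φ.toLp 2‖ * ‖ψ.toLp 2‖) := by
  obtain ⟨C, hC0, hC⟩ := hc.exists_norm_fourier_le hs hχ hχc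
  obtain ⟨B, hB⟩ := hc.norm_iteratedFDeriv_le hs 0
  simp only [norm_iteratedFDeriv_zero] at hB
  set K : E3 → ℝ := fun ζ => C * (1 + ‖ζ‖) ^ (-4 : ℝ)
  have hK : Integrable K := (integrable_one_add_norm (by rw [finrank_E3]; norm_num)).const_mul C
  have hKm : Measurable K := by fun_prop
  have hK0 : ∀ ζ, 0 ≤ K ζ := fun ζ => by positivity
  refine ⟨∫ ζ, K ζ, integral_nonneg hK0, fun φ ψ => ?_⟩
  set E : E3 → E3 → ℂ := fun x η => Complex.exp ((2 * Real.pi * (inner ℝ x η : ℝ) : ℝ) * Complex.I)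
  have hE : ∀ x η, ‖E x η‖ = 1 := fun x η => Complex.norm_exp_ofReal_mul_I _
  have hcont : Continuous (Function.uncurry c) := hc.1.continuous
  have hFψm : Continuous (⇑(𝓕 ψ : 𝓢(E3, ℂ))) := SchwartzMap.continuous _
  have hFφm : Continuous (⇑(𝓕 φ : 𝓢(E3, ℂ))) := SchwartzMap.continuous _
  have hint : Integrable (Function.uncurry fun x η : E3 =>
      E x η * c x ((2 * Real.pi) • η) * 𝓕 φ η * (χ x * ψ x)) (volume.prod volume) := by
    have h1 : Integrable (fun x => χ x * ψ x) :=
      (hχ.continuous.mul ψ.continuous).integrable_of_hasCompactSupport hχc.mul_right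
    have h2 : Integrable (fun p : E3 × E3 => (χ p.1 * ψ p.1) * 𝓕 φ p.2) (volume.prod volume) :=
      h1.mul_prod (𝓕 φ).integrable
    have h3 : Continuous fun p : E3 × E3 => c p.1 ((2 * Real.pi) • p.2) :=
      hcont.comp (g := Function.uncurry c)
        (f := fun p : E3 × E3 => (p.1, (2 * Real.pi) • p.2)) (by fun_prop)
    have h4 : Continuous fun p : E3 × E3 => E p.1 p.2 * c p.1 ((2 * Real.pi) • p.2) :=
      (by fun_prop : Continuous fun p : E3 × E3 => E p.1 p.2).mul h3
    refine (h2.bdd_mul (c := B) h4.aestronglyMeasurable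
      (Filter.Eventually.of_forall fun p => ?_)).congr (Filter.Eventually.of_forall fun p => ?_)
    · rw [norm_mul, hE, one_mul]
      exact hB _ _
    · simp only [Function.uncurry]
      ring
  -- Integrating in `x` first leaves, for each frequency `η`, an integral of the localized symbol
  -- against a modulated `ψ`. Fubini is justified by the compact support of `χ` and the
  -- integrability of `𝓕 φ`.
  have e1 : ∫ x, pseudoOp c φ x * (χ x * ψ x)
      = ∫ η, 𝓕 φ η * ∫ x, E x η * ((χ x * c x ((2 * Real.pi) • η)) * ψ x) := by
    calc ∫ x, pseudoOp c φ x * (χ x * ψ x)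
        = ∫ x, ∫ η, E x η * c x ((2 * Real.pi) • η) * 𝓕 φ η * (χ x * ψ x) := by
          refine integral_congr_ae (Filter.Eventually.of_forall fun x => ?_)
          simp only [pseudoOp_eq_integral_fourier]
          rw [← integral_mul_const]
      _ = ∫ η, ∫ x, E x η * c x ((2 * Real.pi) • η) * 𝓕 φ η * (χ x * ψ x) :=
          integral_integral_swap hint
      _ = _ := by
          refine integral_congr_ae (Filter.Eventually.of_forall fun η => ?_)
          simp only
          rw [← integral_const_mul]
          refine integral_congr_ae (Filter.Eventually.of_forall fun x => ?_)
          simp only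
          ring
  have e2 : ‖∫ x, pseudoOp c φ x * (χ x * ψ x)‖ₑ ≤
      ENNReal.ofReal (∫ ζ, K ζ) * (‖φ.toLp 2‖ₑ * ‖ψ.toLp 2‖ₑ) := by
    rw [e1]
    calc ‖∫ η, 𝓕 φ η * ∫ x, E x η * ((χ x * c x ((2 * Real.pi) • η)) * ψ x)‖ₑ
        ≤ ∫⁻ η, ‖𝓕 φ η‖ₑ * ∫⁻ ζ, ENNReal.ofReal (K ζ) * ‖𝓕 ψ (ζ - η)‖ₑ := by
          refine (enorm_integral_le_lintegral_enorm _).trans (lintegral_mono fun η => ?_)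
          rw [enorm_mul]
          gcongr
          exact enorm_integral_exp_mul_le (hχ.mul (hc.contDiff_left _)) hχc.mul_right (hC _) ψ η
      _ = ∫⁻ η, ∫⁻ ζ, ENNReal.ofReal (K ζ) * (‖𝓕 φ η‖ₑ * ‖𝓕 ψ (ζ - η)‖ₑ) := by
          refine lintegral_congr fun η => ?_
          rw [← lintegral_const_mul' _ _ (by finiteness)]
          refine lintegral_congr fun ζ => ?_
          ring
      _ = ∫⁻ ζ, ∫⁻ η, ENNReal.ofReal (K ζ) * (‖𝓕 φ η‖ₑ * ‖𝓕 ψ (ζ - η)‖ₑ) := by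
          refine lintegral_lintegral_swap (Measurable.aemeasurable ?_)
          change Measurable fun p : E3 × E3 =>
            ENNReal.ofReal (K p.2) * (‖𝓕 φ p.1‖ₑ * ‖𝓕 ψ (p.2 - p.1)‖ₑ)
          have h5 := hFψm.measurable
          have h6 := hFφm.measurable
          fun_prop
      _ ≤ ∫⁻ ζ, ENNReal.ofReal (K ζ) * (‖φ.toLp 2‖ₑ * ‖ψ.toLp 2‖ₑ) := by
          refine lintegral_mono fun ζ => ?_
          rw [lintegral_const_mul' _ _ (by finiteness)]
          gcongr
          -- For fixed `ζ`, Cauchy–Schwarz in `η` and Plancherel give `‖φ‖ ‖ψ‖`, independently of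
          -- the shift; the remaining integral in `ζ` is the constant.
          have h := ENNReal.lintegral_mul_le_Lp_mul_Lq (volume : Measure E3) (p := 2) (q := 2)
            (by norm_num [Real.holderConjugate_iff]) (f := fun η => ‖𝓕 φ η‖ₑ)
            (g := fun η => ‖𝓕 ψ (ζ - η)‖ₑ) (by fun_prop)
            (hFψm.comp (continuous_const.sub continuous_id)).enorm.measurable.aemeasurable
          refine h.trans_eq ?_
          have e3 : ∫⁻ η, ‖𝓕 ψ (ζ - η)‖ₑ ^ (2 : ℝ) = ‖ψ.toLp 2‖ₑ ^ 2 := by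
            rw [lintegral_sub_left_eq_self (fun η => ‖𝓕 ψ η‖ₑ ^ (2 : ℝ)),
              ← lintegral_enorm_sq_fourier]
            norm_num
          have e4 : ∫⁻ η, ‖𝓕 φ η‖ₑ ^ (2 : ℝ) = ‖φ.toLp 2‖ₑ ^ 2 := by
            rw [← lintegral_enorm_sq_fourier]
            norm_num
          have e5 : ∀ t : ℝ≥0∞, (t ^ 2) ^ (1 / 2 : ℝ) = t := fun t => by
            rw [← ENNReal.rpow_natCast, ← ENNReal.rpow_mul]; norm_num
          simp only [e3, e4, e5]
      _ = _ := by
          rw [lintegral_mul_const _ (by fun_prop), ← ofReal_integral_eq_lintegral_ofReal hK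
            (Filter.Eventually.of_forall hK0)]
  have h := ENNReal.toReal_mono (by finiteness) e2
  rwa [ENNReal.toReal_mul, ENNReal.toReal_mul, ENNReal.toReal_ofReal (integral_nonneg hK0),
    toReal_enorm, toReal_enorm, toReal_enorm] at h

end PseudoOp

/-! ### Separability of the space of test functions supported in a ball -/

section Separability

/-- Schwartz functions supported in the closed ball of radius `N`. -/
def schwartzBall (N : ℝ) : Set 𝓢(E3, ℂ) := {φ | tsupport φ ⊆ Metric.closedBall 0 N}

/-- All derivatives of a Schwartz function, as continuous functions. -/
def schwartzJet (φ : 𝓢(E3, ℂ)) (n : ℕ) : C(E3, ContinuousMultilinearMap ℝ (fun _ : Fin n => E3) ℂ) :=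
  ⟨iteratedFDeriv ℝ n φ, (φ.smooth ⊤).continuous_iteratedFDeriv (by exact_mod_cast le_top)⟩

/-- Makes the spaces of continuous maps holding the jets second countable, so that any set of jets
is separable. -/
instance secondCountable_multilinear (n : ℕ) :
    SecondCountableTopology (ContinuousMultilinearMap ℝ (fun _ : Fin n => E3) ℂ) := by
  have : FiniteDimensional ℝ (ContinuousMultilinearMap ℝ (fun _ : Fin n => E3) ℂ) :=
    Module.Finite.of_injective
      (ContinuousMultilinearMap.toMultilinearMapLinear (R' := ℝ) (A := ℝ) (M₁ := fun _ : Fin n => E3)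
        (M₂ := ℂ))
      ContinuousMultilinearMap.toMultilinearMap_injective
  have : ProperSpace (ContinuousMultilinearMap ℝ (fun _ : Fin n => E3) ℂ) :=
    FiniteDimensional.proper_real _
  infer_instance

/-- With all supports in one ball the polynomial weights are at most `|N|^k`, so locally uniform
convergence of each derivative already controls every Schwartz seminorm. -/
lemma tendsto_schwartz_of_tendsto_jet {N : ℝ} {q : ℕ → 𝓢(E3, ℂ)} {φ : 𝓢(E3, ℂ)}
    (hq : ∀ j, q j ∈ schwartzBall N) (hφ : φ ∈ schwartzBall N)
    (h : Filter.Tendsto (fun j => schwartzJet (q j)) Filter.atTop (𝓝 (schwartzJet φ))) :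
    Filter.Tendsto q Filter.atTop (𝓝 φ) := by
  rw [(schwartz_withSeminorms ℝ E3 ℂ).tendsto_nhds]
  rintro ⟨k, n⟩ ε hε
  have h1 := (ContinuousMap.tendsto_iff_forall_isCompact_tendstoUniformlyOn.1
    ((tendsto_pi_nhds.1 h) n)) _ (isCompact_closedBall (0 : E3) N)
  rw [Metric.tendstoUniformlyOn_iff] at h1
  filter_upwards [h1 (ε / 2 / (|N| ^ k + 1)) (by positivity)] with j hj
  refine lt_of_le_of_lt (SchwartzMap.seminorm_le_bound ℝ k n _ (M := ε / 2) (by positivity)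
    fun x => ?_) (half_lt_self hε)
  have e : iteratedFDeriv ℝ n (⇑(q j - φ)) x = iteratedFDeriv ℝ n (q j) x - iteratedFDeriv ℝ n φ x := by
    have := iteratedFDeriv_sub_apply (𝕜 := ℝ) (i := n) (x := x) ((q j).contDiffAt n) (φ.contDiffAt n)
    rw [← this]
    rfl
  rw [e]
  by_cases hx : x ∈ Metric.closedBall (0 : E3) N
  · have h2 := (hj x hx).le
    rw [dist_comm, dist_eq_norm] at h2
    have h3 : ‖x‖ ≤ |N| := (mem_closedBall_zero_iff.1 hx).trans (le_abs_self N)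
    calc ‖x‖ ^ k * ‖iteratedFDeriv ℝ n (q j) x - iteratedFDeriv ℝ n φ x‖
        ≤ |N| ^ k * (ε / 2 / (|N| ^ k + 1)) := by
          gcongr
          exact h2
      _ ≤ ε / 2 := by
          rw [mul_div_assoc', div_le_iff₀ (by positivity)]
          nlinarith [pow_nonneg (abs_nonneg N) k]
  · have h4 : ∀ θ ∈ schwartzBall N, iteratedFDeriv ℝ n (⇑θ) x = 0 := fun θ hθ => by
      by_contra h5
      exact hx (hθ (support_iteratedFDeriv_subset n h5))
    rw [h4 _ (hq j), h4 _ hφ]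
    simp
    positivity

/-- The jets form a subset of a second countable product, so they have a countable dense subset;
sequences there lift back to Schwartz convergence. It serves to exchange "almost surely" with "for
every test function". -/
lemma exists_countable_dense_schwartzBall (N : ℝ) :
    ∃ Q ⊆ schwartzBall N, Q.Countable ∧ schwartzBall N ⊆ closure Q := by
  set s : Set (∀ n, C(E3, ContinuousMultilinearMap ℝ (fun _ : Fin n => E3) ℂ)) :=
    schwartzJet '' schwartzBall N
  obtain ⟨t, htc, htd⟩ := TopologicalSpace.exists_countable_dense s
  choose! g hg using fun y (hy : y ∈ s) => hy
  refine ⟨(fun y : s => g y) '' t, ?_, htc.image _, fun φ hφ => ?_⟩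
  · rintro _ ⟨y, -, rfl⟩
    exact (hg y y.2).1
  · have h1 : (⟨schwartzJet φ, φ, hφ, rfl⟩ : s) ∈ closure t := htd _
    obtain ⟨y, hyt, hy⟩ := mem_closure_iff_seq_limit.1 h1
    refine mem_closure_of_tendsto (tendsto_schwartz_of_tendsto_jet (q := fun j => g (y j))
      (fun j => (hg _ (y j).2).1) hφ ?_) (Filter.Eventually.of_forall fun j => ⟨y j, hyt j, rfl⟩)
    simp only [fun j => (hg _ (y j).2).2]
    exact (continuous_subtype_val.tendsto _).comp hy

end Separability

/-! ### Convolution of a Schwartz function with a rapidly decreasing integrable kernel -/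

section Convolution

open FourierTransform

/-- Each derivative of `𝓕 h` is the transform of a moment of `h`, hence bounded; the growth exponent
can be taken to be `0`. -/
lemma hasTemperateGrowth_fourier {h : E3 → ℂ} (hm : AEStronglyMeasurable h)
    (hh : ∀ n : ℕ, Integrable fun v => ‖v‖ ^ n * ‖h v‖) : (𝓕 h).HasTemperateGrowth := by
  refine ⟨Real.contDiff_fourier fun n _ => hh n, fun n => ⟨0,
    ∫ v, (2 * Real.pi * ‖innerSL ℝ (E := E3)‖) ^ n * (‖v‖ ^ n * ‖h v‖), fun x => ?_⟩⟩
  rw [pow_zero, mul_one, Real.iteratedFDeriv_fourier (N := ⊤) (fun n _ => hh n) hm (by simp)]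
  refine (VectorFourier.norm_fourierIntegral_le_integral_norm _ _ _ _ _).trans ?_
  refine integral_mono_of_nonneg (Filter.Eventually.of_forall fun v => norm_nonneg _)
    ((hh n).const_mul _) (Filter.Eventually.of_forall fun v => ?_)
  simp only
  rw [← mul_assoc]
  exact VectorFourier.norm_fourierPowSMulRight_le _ _ _ _

/-- By the convolution theorem and Fourier inversion. Realizing the convolution as a multiplier
makes it a continuous map of Schwartz space, even though the kernel may be singular. -/
lemma fourierMultiplier_fourier_apply {h : E3 → ℂ} (hm : AEStronglyMeasurable h)
    (hh : ∀ n : ℕ, Integrable fun v => ‖v‖ ^ n * ‖h v‖) (φ : 𝓢(E3, ℂ)) (y : E3) :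
    SchwartzMap.fourierMultiplierCLM ℂ (𝓕 h) φ y = ∫ x, h (y - x) * φ x := by
  have hi : Integrable h := by
    have := hh 0
    simp only [pow_zero, one_mul] at this
    exact (integrable_norm_iff hm).1 this
  set g : E3 → ℂ := MeasureTheory.convolution h φ (ContinuousLinearMap.mul ℂ ℂ) volume
  have hgc : Continuous g := by
    refine BddAbove.continuous_convolution_right_of_integrable _ ?_ hi φ.continuous
    exact ⟨SchwartzMap.seminorm ℝ 0 0 φ, by rintro _ ⟨x, rfl⟩; exact φ.norm_le_seminorm ℝ x⟩
  have hgi : Integrable g := hi.integrable_convolution _ φ.integrable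
  have hF : 𝓕 g = ⇑(SchwartzMap.smulLeftCLM ℂ (𝓕 h) (𝓕 φ)) := by
    ext ξ
    rw [SchwartzMap.smulLeftCLM_apply_apply (hasTemperateGrowth_fourier hm hh)]
    exact Real.fourier_mul_convolution_eq hi φ.integrable ξ
  have h1 := Continuous.fourierInv_fourier_eq hgc hgi (by rw [hF]; exact SchwartzMap.integrable _)
  rw [SchwartzMap.fourierMultiplierCLM_apply, SchwartzMap.fourierInv_coe, ← hF, h1]
  exact MeasureTheory.convolution_eq_swap _

end Convolution

/-- The kernel `Φ_k(·, 0)` truncated to a ball. -/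
def truncPhi (k R : ℝ) : E3 → ℂ := (Metric.ball (0 : E3) R).indicator fun z => Phi k z 0

lemma measurable_truncPhi (k R : ℝ) : Measurable (truncPhi k R) := by
  refine Measurable.indicator ?_ measurableSet_ball
  unfold Phi
  fun_prop

lemma integrable_pow_mul_truncPhi (k R : ℝ) (n : ℕ) :
    Integrable fun z => ‖z‖ ^ n * ‖truncPhi k R z‖ := by
  have h := (integrable_indicator_iff measurableSet_ball).2 (integrableOn_norm_inv_pow (p := 1)
    (by norm_num) R)
  refine (h.const_mul (|R| ^ n)).mono' ?_ (Filter.Eventually.of_forall fun z => ?_)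
  · have := measurable_truncPhi k R
    fun_prop
  · rw [Real.norm_of_nonneg (by positivity)]
    by_cases hz : z ∈ Metric.ball (0 : E3) R
    · have h1 : ‖z‖ ≤ |R| := (mem_ball_zero_iff.1 hz).le.trans (le_abs_self R)
      rw [truncPhi, Set.indicator_of_mem hz, Set.indicator_of_mem hz, pow_one]
      gcongr
      simpa using norm_Phi_le k z 0
    · simp [truncPhi, Set.indicator_of_notMem hz]

/-- The operator `φ ↦ ∫ Φ_k(x, ·) φ(x) dx` with truncated kernel, on Schwartz functions. -/
def truncResolvent (k R : ℝ) : 𝓢(E3, ℂ) →L[ℂ] 𝓢(E3, ℂ) :=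
  SchwartzMap.fourierMultiplierCLM ℂ (FourierTransform.fourier (truncPhi k R))

/-- For `|y| ≤ r` and `x` in the support of `φ` one has `|y-x| ≤ r + N < R`, so the truncation is
not seen. -/
lemma truncResolvent_apply {k R r N : ℝ} (hR : r + N < R) {φ : 𝓢(E3, ℂ)} (hφ : φ ∈ schwartzBall N)
    {y : E3} (hy : ‖y‖ ≤ r) : truncResolvent k R φ y = ∫ x, Phi k x y * φ x := by
  rw [truncResolvent, fourierMultiplier_fourier_apply (measurable_truncPhi k R).aestronglyMeasurable
    (integrable_pow_mul_truncPhi k R)]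
  refine integral_congr_ae (Filter.Eventually.of_forall fun x => ?_)
  by_cases hx : x ∈ Metric.closedBall (0 : E3) N
  · have h1 : y - x ∈ Metric.ball (0 : E3) R := by
      rw [mem_ball_zero_iff]
      have := norm_sub_le y x
      have := mem_closedBall_zero_iff.1 hx
      linarith
    simp only [truncPhi, Set.indicator_of_mem h1, Phi_eq_sub k x y]
  · have h2 : φ x = 0 := by
      by_contra h3
      exact hx (hφ (subset_tsupport _ h3))
    simp [h2]

/-! ### Second moments of the source -/

lemma integrable_norm_sq_of_memLp {β : Type*} [MeasurableSpace β] {ν : Measure β} {g : β → ℂ}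
    (hg : MemLp g 2 ν) : Integrable (fun x => ‖g x‖ ^ 2) ν :=
  (memLp_two_iff_integrable_sq_norm hg.1).1 hg

lemma norm_sq_toLp {β : Type*} [MeasurableSpace β] {ν : Measure β} {g : β → ℂ} (hg : MemLp g 2 ν) :
    ‖hg.toLp g‖ ^ 2 = ∫ x, ‖g x‖ ^ 2 ∂ν := by
  have h := lintegral_enorm_sq_Lp (hg.toLp g)
  have h2 : ∫⁻ x, ‖hg.toLp g x‖ₑ ^ 2 ∂ν = ∫⁻ x, ENNReal.ofReal (‖g x‖ ^ 2) ∂ν := by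
    refine lintegral_congr_ae ?_
    filter_upwards [hg.coeFn_toLp] with x hx
    rw [hx, ← ofReal_norm, ENNReal.ofReal_pow (norm_nonneg _)]
  rw [h2, ← ofReal_integral_eq_lintegral_ofReal (integrable_norm_sq_of_memLp hg)
    (Filter.Eventually.of_forall fun x => by positivity)] at h
  have h3 := congrArg ENNReal.toReal h
  rw [ENNReal.toReal_ofReal (integral_nonneg fun x => by positivity), ENNReal.toReal_pow,
    toReal_enorm] at h3
  exact h3.symm

lemma norm_sq_schwartz_toLp (φ : 𝓢(E3, ℂ)) : ‖φ.toLp 2‖ ^ 2 = ∫ x, ‖φ x‖ ^ 2 := by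
  rw [SchwartzMap.toLp, norm_sq_toLp]

lemma norm_toLp_le_of_norm_le {φ ψ : 𝓢(E3, ℂ)} (h : ∀ x, ‖φ x‖ ≤ ‖ψ x‖) :
    ‖φ.toLp 2‖ ≤ ‖ψ.toLp 2‖ := by
  refine le_of_sq_le_sq ?_ (norm_nonneg _)
  rw [norm_sq_schwartz_toLp, norm_sq_schwartz_toLp]
  refine integral_mono (integrable_norm_sq_of_memLp (φ.memLp 2)) (integrable_norm_sq_of_memLp (ψ.memLp 2)) fun x => ?_
  exact pow_le_pow_left₀ (norm_nonneg _) (h x) 2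

lemma conjSchwartz_apply (φ : 𝓢(E3, ℂ)) (x : E3) : conjSchwartz φ x = (starRingEnd ℂ) (φ x) := rfl

lemma conjSchwartz_conjSchwartz (φ : 𝓢(E3, ℂ)) : conjSchwartz (conjSchwartz φ) = φ := by
  ext x
  simp [conjSchwartz_apply]

lemma norm_integral_mul_le_toLp (φ ψ : 𝓢(E3, ℂ)) : ‖∫ x, φ x * ψ x‖ ≤ ‖φ.toLp 2‖ * ‖ψ.toLp 2‖ := by
  have h := SchwartzMap.inner_toL2_toL2_eq (conjSchwartz φ) ψ volume
  have e : ∫ x, φ x * ψ x = ∫ x, inner ℂ (conjSchwartz φ x) (ψ x) := by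
    refine integral_congr_ae (Filter.Eventually.of_forall fun x => ?_)
    simp [conjSchwartz_apply, mul_comm]
  rw [e, ← h]
  refine (norm_inner_le_norm _ _).trans ?_
  gcongr
  exact norm_toLp_le_of_norm_le fun x => by simp [conjSchwartz_apply]

section Source

variable {Ω : Type*} [MeasurableSpace Ω] {P : Measure Ω}
  {D : Set E3} {m : ℝ} {μ : E3 → ℝ} {f : Ω → 𝓢'(E3, ℂ)}

lemma IsGaussianDistribution.memLp (hf : IsGaussianDistribution P f) (φ : 𝓢(E3, ℂ)) :
    MemLp (fun ω => f ω φ) 2 P := (hf.gaussian φ).memLp_two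

variable [IsProbabilityMeasure P]

/-- Splits the second moment into variance and squared mean. The variance is bounded by the `L²`
estimate for the covariance symbol, the mean by Cauchy–Schwarz against its smooth density. -/
lemma IsMicrolocallyIsotropic.exists_second_moment_le (hf : IsMicrolocallyIsotropic P f m μ D)
    (hm : 0 ≤ m) {χ : E3 → ℂ} (hχ : ContDiff ℝ (⊤ : ℕ∞) χ) (hχc : HasCompactSupport χ)
    (hχ1 : ∀ x, ‖χ x‖ ≤ 1) :
    ∃ C : ℝ, 0 ≤ C ∧ ∀ ψ : 𝓢(E3, ℂ),
      ∫ ω, ‖f ω (SchwartzMap.smulLeftCLM ℂ χ ψ)‖ ^ 2 ∂P ≤ C * ‖ψ.toLp 2‖ ^ 2 := by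
  obtain ⟨c, h, ⟨hsym, -⟩, -, hcov⟩ := hf.covariance
  obtain ⟨C, hC0, hC⟩ := hsym.exists_norm_integral_pseudoOp_le (by linarith) hχ hχc
  obtain ⟨g, hg, hgc, -, hmean⟩ := hf.expectation
  set G : 𝓢(E3, ℂ) := hgc.toSchwartzMap hg
  have hχt : χ.HasTemperateGrowth := hχc.hasTemperateGrowth hχ
  refine ⟨2 * C + 2 * ‖G.toLp 2‖ ^ 2, by positivity, fun ψ => ?_⟩
  set a := SchwartzMap.smulLeftCLM ℂ χ ψ
  have ha : ∀ x, a x = χ x * ψ x := fun x => SchwartzMap.smulLeftCLM_apply_apply hχt ψ x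
  have ha2 : ‖a.toLp 2‖ ≤ ‖ψ.toLp 2‖ := norm_toLp_le_of_norm_le fun x => by
    rw [ha, norm_mul]
    exact mul_le_of_le_one_left (norm_nonneg _) (hχ1 x)
  set M : ℂ := ∫ ω, f ω a ∂P
  have hM : ‖M‖ ≤ ‖G.toLp 2‖ * ‖ψ.toLp 2‖ := by
    have : M = ∫ x, G x * a x := hmean a
    rw [this]
    refine (norm_integral_mul_le_toLp G a).trans ?_
    gcongr
  have hZ : MemLp (centered P f a) 2 P := (hf.isGaussian.memLp a).sub (memLp_const M)
  have hcovle : ∫ ω, ‖centered P f a ω‖ ^ 2 ∂P ≤ C * ‖ψ.toLp 2‖ ^ 2 := by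
    -- The covariance conjugates its first argument, so the variance of `⟨f, a⟩` is its value at
    -- `(conj a, a)`.
    have e1 : covarianceOp P f (conjSchwartz a) a = ((∫ ω, ‖centered P f a ω‖ ^ 2 ∂P : ℝ) : ℂ) := by
      rw [covarianceOp, conjSchwartz_conjSchwartz, ← integral_complex_ofReal]
      refine integral_congr_ae (Filter.Eventually.of_forall fun ω => ?_)
      simp only
      rw [mul_comm, Complex.mul_conj, Complex.normSq_eq_norm_sq]
    have e2 := hcov (conjSchwartz a) a
    rw [e1] at e2
    simp only [ha] at e2
    have e3 := hC (conjSchwartz a) ψ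
    rw [← e2, Complex.norm_real, Real.norm_of_nonneg (integral_nonneg fun ω => by positivity)] at e3
    refine e3.trans ?_
    rw [pow_two]
    gcongr
    exact (norm_toLp_le_of_norm_le fun x => by simp [conjSchwartz_apply]).trans ha2
  calc ∫ ω, ‖f ω a‖ ^ 2 ∂P ≤ ∫ ω, (2 * ‖centered P f a ω‖ ^ 2 + 2 * ‖M‖ ^ 2) ∂P := by
        refine integral_mono (integrable_norm_sq_of_memLp (hf.isGaussian.memLp a))
          (((integrable_norm_sq_of_memLp hZ).const_mul 2).add (integrable_const _)) fun ω => ?_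
        have e : f ω a = centered P f a ω + M := by simp [centered, M]
        have := norm_add_le (centered P f a ω) M
        rw [← e] at this
        have h2 := pow_le_pow_left₀ (norm_nonneg _) this 2
        simp only
        nlinarith [sq_nonneg (‖centered P f a ω‖ - ‖M‖)]
    _ = 2 * ∫ ω, ‖centered P f a ω‖ ^ 2 ∂P + 2 * ‖M‖ ^ 2 := by
        rw [integral_add ((integrable_norm_sq_of_memLp hZ).const_mul 2) (integrable_const _), integral_const_mul]
        simp
    _ ≤ 2 * (C * ‖ψ.toLp 2‖ ^ 2) + 2 * (‖G.toLp 2‖ * ‖ψ.toLp 2‖) ^ 2 := by gcongr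
    _ = _ := by ring

/-- The localized source extends to a bounded operator from `L²(ℝ³)` to `L²(P)`. -/
lemma IsMicrolocallyIsotropic.exists_L2_extension (hf : IsMicrolocallyIsotropic P f m μ D)
    (hm : 0 ≤ m) {χ : E3 → ℂ} (hχ : ContDiff ℝ (⊤ : ℕ∞) χ) (hχc : HasCompactSupport χ)
    (hχ1 : ∀ x, ‖χ x‖ ≤ 1) :
    ∃ X : Lp ℂ 2 (volume : Measure E3) →L[ℂ] Lp ℂ 2 P, ∀ ψ : 𝓢(E3, ℂ),
      X (ψ.toLp 2) =ᵐ[P] fun ω => f ω (SchwartzMap.smulLeftCLM ℂ χ ψ) := by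
  obtain ⟨C, hC0, hC⟩ := hf.exists_second_moment_le hm hχ hχc hχ1
  set T : 𝓢(E3, ℂ) → Lp ℂ 2 P := fun ψ =>
    (hf.isGaussian.memLp (SchwartzMap.smulLeftCLM ℂ χ ψ)).toLp _
  have hT : ∀ ψ, T ψ =ᵐ[P] fun ω => f ω (SchwartzMap.smulLeftCLM ℂ χ ψ) := fun ψ =>
    MemLp.coeFn_toLp _
  set L : 𝓢(E3, ℂ) →ₗ[ℂ] Lp ℂ 2 P :=
    { toFun := T
      map_add' := fun φ ψ => by
        refine Lp.ext ?_
        filter_upwards [hT (φ + ψ), hT φ, hT ψ, Lp.coeFn_add (T φ) (T ψ)] with ω h1 h2 h3 h4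
        rw [h1, h4, Pi.add_apply, h2, h3, map_add, map_add]
      map_smul' := fun a φ => by
        refine Lp.ext ?_
        filter_upwards [hT (a • φ), hT φ, Lp.coeFn_smul a (T φ)] with ω h1 h2 h4
        rw [h1, RingHom.id_apply, h4, Pi.smul_apply, h2, map_smul, map_smul] }
  set e : 𝓢(E3, ℂ) →ₗ[ℂ] Lp ℂ 2 (volume : Measure E3) := (SchwartzMap.toLpCLM ℂ ℂ 2 volume).toLinearMap
  have hdense : DenseRange e := SchwartzMap.denseRange_toLpCLM (by norm_num)
  have hbound : ∀ ψ, ‖L ψ‖ ≤ Real.sqrt C * ‖e ψ‖ := fun ψ => by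
    refine le_of_sq_le_sq ?_ (by positivity)
    rw [mul_pow, Real.sq_sqrt hC0]
    exact (norm_sq_toLp (hf.isGaussian.memLp (SchwartzMap.smulLeftCLM ℂ χ ψ))).trans_le (hC ψ)
  refine ⟨L.extendOfNorm e, fun ψ => ?_⟩
  have : L.extendOfNorm e (ψ.toLp 2) = L ψ := LinearMap.extendOfNorm_eq hdense ⟨_, hbound⟩ ψ
  rw [this]
  exact hT ψ

end Source

/-! ### The localized kernel as an element of `L²` -/

section Kernel

variable {χ : E3 → ℂ} {R k : ℝ}

/-- The singularity `|x-y|⁻¹` is locally square integrable in `ℝ³`; the decay is the square root of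
that in `lintegral_ball_enorm_Phi_sq_le`. -/
lemma exists_localized_kernel (k : ℝ) (hχ : Continuous χ) (hχ1 : ∀ x, ‖χ x‖ ≤ 1)
    (hχR : Function.support χ ⊆ Metric.ball 0 R) :
    ∃ (C : ℝ) (κ : E3 → Lp ℂ 2 (volume : Measure E3)), 0 ≤ C ∧
      (∀ x, κ x =ᵐ[volume] fun y => χ y * Phi k x y) ∧
      ∀ x, ‖κ x‖ ≤ Real.sqrt C * bracket x ^ (-1 : ℝ) := by
  obtain ⟨C, hC0, hC⟩ := lintegral_ball_enorm_Phi_sq_le k R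
  have hle : ∀ x, ∫⁻ y, ‖χ y * Phi k x y‖ₑ ^ 2 ≤ ENNReal.ofReal (C * bracket x ^ (-2 : ℝ)) := by
    intro x
    refine le_trans ?_ (hC x)
    rw [← lintegral_indicator measurableSet_ball]
    refine lintegral_mono fun y => ?_
    by_cases hy : y ∈ Metric.ball (0 : E3) R
    · rw [Set.indicator_of_mem hy, enorm_mul]
      gcongr
      refine mul_le_of_le_one_left' ?_
      rw [← ofReal_norm, ENNReal.ofReal_le_one]
      exact hχ1 y
    · have : χ y = 0 := by
        by_contra h
        exact hy (hχR h)
      simp [this]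
  have hmem : ∀ x, MemLp (fun y => χ y * Phi k x y) 2 volume := fun x =>
    memLp_two_iff_lintegral.2 ⟨hχ.aestronglyMeasurable.mul
      (measurable_Phi_right k x).aestronglyMeasurable, (hle x).trans_lt ENNReal.ofReal_lt_top⟩
  refine ⟨C, fun x => (hmem x).toLp _, hC0, fun x => (hmem x).coeFn_toLp, fun x => ?_⟩
  refine le_of_sq_le_sq ?_ (by have := bracket_rpow_pos x (-1); positivity)
  have h1 : ‖(hmem x).toLp _‖ₑ ^ 2 ≤ ENNReal.ofReal (C * bracket x ^ (-2 : ℝ)) := by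
    rw [← lintegral_enorm_sq_Lp]
    refine le_trans (le_of_eq (lintegral_congr_ae ?_)) (hle x)
    filter_upwards [(hmem x).coeFn_toLp] with y hy
    rw [hy]
  have h2 := ENNReal.toReal_mono ENNReal.ofReal_ne_top h1
  rw [ENNReal.toReal_pow, toReal_enorm, ENNReal.toReal_ofReal
    (by have := bracket_rpow_pos x (-2); positivity)] at h2
  rw [mul_pow, Real.sq_sqrt hC0, ← Real.rpow_mul_natCast (bracket_pos x).le]
  norm_num at h2 ⊢
  exact h2

variable {κ : E3 → Lp ℂ 2 (volume : Measure E3)}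

lemma inner_localized_kernel (hκ : ∀ x, κ x =ᵐ[volume] fun y => χ y * Phi k x y)
    (h : Lp ℂ 2 (volume : Measure E3)) (x : E3) :
    inner ℂ h (κ x) = ∫ y, χ y * Phi k x y * (starRingEnd ℂ) (h y) := by
  rw [L2.inner_def]
  refine integral_congr_ae ?_
  filter_upwards [hκ x] with y hy
  rw [hy]
  simp

lemma measurable_inner_localized_kernel (hχ : Continuous χ)
    (hκ : ∀ x, κ x =ᵐ[volume] fun y => χ y * Phi k x y) (h : Lp ℂ 2 (volume : Measure E3)) :
    Measurable fun x => inner ℂ h (κ x) := by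
  simp only [inner_localized_kernel hκ]
  have hm : Measurable (h : E3 → ℂ) := (Lp.stronglyMeasurable h).measurable
  have hΦ := measurable_Phi k
  have hχm := hχ.measurable
  have : Measurable (Function.uncurry fun x y : E3 => χ y * Phi k x y * (starRingEnd ℂ) (h y)) := by
    change Measurable fun p : E3 × E3 => χ p.2 * Phi k p.1 p.2 * (starRingEnd ℂ) (h p.2)
    fun_prop
  exact this.stronglyMeasurable.integral_prod_right.measurable

/-- By Fubini: `g` is the weak integral of `φ(x) κ(x)` in `L²`, which is what
`exists_measurable_version` demands of `Kφ`. Absolute integrability follows from the uniform bound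
on `‖κ x‖` and `φ ∈ L¹`. -/
lemma inner_toLp_eq_integral_inner_kernel (hχ : Continuous χ)
    (hκ : ∀ x, κ x =ᵐ[volume] fun y => χ y * Phi k x y) {B : ℝ} (hκB : ∀ x, ‖κ x‖ ≤ B)
    {φ : 𝓢(E3, ℂ)} {g : 𝓢(E3, ℂ)} (hg : ∀ y, g y = χ y * ∫ x, Phi k x y * φ x)
    (h : Lp ℂ 2 (volume : Measure E3)) :
    inner ℂ h (g.toLp 2) = ∫ x, φ x * inner ℂ h (κ x) := by
  have hm : Measurable (h : E3 → ℂ) := (Lp.stronglyMeasurable h).measurable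
  have hΦ := measurable_Phi k
  have hχm := hχ.measurable
  have hφm := φ.continuous.measurable
  have hint1 : ∀ x, Integrable fun y => χ y * Phi k x y * (starRingEnd ℂ) (h y) := fun x => by
    refine (L2.integrable_inner (𝕜 := ℂ) h (κ x)).congr ?_
    filter_upwards [hκ x] with y hy
    rw [hy]
    simp
  have hle : ∀ x, ∫ y, ‖χ y * Phi k x y * (starRingEnd ℂ) (h y)‖ ≤ ‖h‖ * B := fun x => by
    have h1 := integral_mul_norm_le_Lp_mul_Lq (μ := (volume : Measure E3)) (p := 2) (q := 2)
      (f := κ x) (g := h) (by norm_num [Real.holderConjugate_iff])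
      (by simpa using Lp.memLp (κ x)) (by simpa using Lp.memLp h)
    have h2 : ∀ l : Lp ℂ 2 (volume : Measure E3), (∫ a, ‖l a‖ ^ (2 : ℝ)) ^ (1 / (2 : ℝ)) = ‖l‖ := by
      intro l
      have := norm_sq_toLp (Lp.memLp l)
      rw [Lp.toLp_coeFn] at this
      simp only [Real.rpow_two]
      rw [← this, ← Real.sqrt_eq_rpow, Real.sqrt_sq (norm_nonneg _)]
    rw [h2, h2] at h1
    have h3 : ∫ y, ‖χ y * Phi k x y * (starRingEnd ℂ) (h y)‖ = ∫ y, ‖κ x y‖ * ‖h y‖ := by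
      refine integral_congr_ae ?_
      filter_upwards [hκ x] with y hy
      rw [hy, norm_mul, RCLike.norm_conj]
    rw [h3]
    refine h1.trans ?_
    rw [mul_comm]
    gcongr
    exact hκB x
  have hint : Integrable (Function.uncurry fun x y : E3 =>
      φ x * (χ y * Phi k x y * (starRingEnd ℂ) (h y))) (volume.prod volume) := by
    have hmeas : Measurable (Function.uncurry fun x y : E3 =>
        φ x * (χ y * Phi k x y * (starRingEnd ℂ) (h y))) := by
      change Measurable fun p : E3 × E3 =>
        φ p.1 * (χ p.2 * Phi k p.1 p.2 * (starRingEnd ℂ) (h p.2))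
      fun_prop
    refine (integrable_prod_iff hmeas.aestronglyMeasurable).2
      ⟨Filter.Eventually.of_forall fun x => (hint1 x).const_mul (φ x), ?_⟩
    refine (φ.integrable.norm.mul_const (‖h‖ * B)).mono'
      hmeas.stronglyMeasurable.norm.integral_prod_right.aestronglyMeasurable
      (Filter.Eventually.of_forall fun x => ?_)
    rw [Real.norm_of_nonneg (integral_nonneg fun y => norm_nonneg _)]
    simp only [Function.uncurry, norm_mul (φ x)]
    rw [integral_const_mul]
    gcongr
    exact hle x
  calc inner ℂ h (g.toLp 2) = ∫ y, ∫ x, φ x * (χ y * Phi k x y * (starRingEnd ℂ) (h y)) := by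
        rw [L2.inner_def]
        refine integral_congr_ae ?_
        filter_upwards [SchwartzMap.coeFn_toLp g 2] with y hy
        rw [hy, hg]
        have e : ∀ x, φ x * (χ y * Phi k x y * (starRingEnd ℂ) (h y))
            = (χ y * (starRingEnd ℂ) (h y)) * (Phi k x y * φ x) := fun x => by ring
        simp only [e, integral_const_mul, RCLike.inner_apply]
        ring
    _ = ∫ x, ∫ y, φ x * (χ y * Phi k x y * (starRingEnd ℂ) (h y)) :=
        (integral_integral_swap hint).symm
    _ = ∫ x, φ x * inner ℂ h (κ x) := by
        refine integral_congr_ae (Filter.Eventually.of_forall fun x => ?_)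
        simp only [integral_const_mul]
        rw [inner_localized_kernel hκ]

end Kernel

/-! ### The resolvent of the source -/

lemma MemWeighted.of_le {δ δ' : ℝ} (h : δ' ≤ δ) {φ : E3 → ℂ} (hφ : MemWeighted 2 δ φ) :
    MemWeighted 2 δ' φ := by
  rw [memWeighted_iff, weightedNorm_lt_top_iff] at hφ ⊢
  refine ⟨hφ.1, lt_of_le_of_lt (lintegral_mono fun x => ?_) hφ.2⟩
  gcongr
  exact one_le_bracket x

lemma MemWeighted.locallyIntegrable {δ : ℝ} {φ : E3 → ℂ} (hφ : MemWeighted 2 δ φ) :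
    LocallyIntegrable φ := by
  have h1 : LocallyIntegrable fun x => ((bracket x ^ δ : ℝ) : ℂ) * φ x :=
    MemLp.locallyIntegrable hφ (by norm_num)
  have h2 : Continuous fun x : E3 => ((bracket x ^ (-δ) : ℝ) : ℂ) :=
    Complex.continuous_ofReal.comp (continuous_bracket_rpow _)
  rw [locallyIntegrable_iff] at h1 ⊢
  intro K hK
  refine ((h1 K hK).continuousOn_mul h2.continuousOn hK).congr
    (Filter.Eventually.of_forall fun x => ?_)
  simp only [← mul_assoc, ← Complex.ofReal_mul, ← Real.rpow_add (bracket_pos x)]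
  simp

/-- Dominated convergence: near `φ` the supremum seminorm is at most its value at `φ` plus one. -/
lemma continuous_integral_mul_schwartz {w : E3 → ℂ} (hw : Integrable w) :
    Continuous fun φ : 𝓢(E3, ℂ) => ∫ x, w x * φ x := by
  refine continuous_iff_continuousAt.2 fun φ => ?_
  have hs : Continuous fun φ : 𝓢(E3, ℂ) => SchwartzMap.seminorm ℝ 0 0 φ :=
    (schwartz_withSeminorms ℝ E3 ℂ).continuous_seminorm (0, 0)
  refine continuousAt_of_dominated (bound := fun x => ‖w x‖ * (SchwartzMap.seminorm ℝ 0 0 φ + 1))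
    (Filter.Eventually.of_forall fun ψ => hw.1.mul ψ.continuous.aestronglyMeasurable) ?_
    (hw.norm.mul_const _) (Filter.Eventually.of_forall fun x => ?_)
  · filter_upwards [hs.continuousAt.eventually_lt_const (lt_add_one (SchwartzMap.seminorm ℝ 0 0 φ))]
      with ψ hψ
    refine Filter.Eventually.of_forall fun x => ?_
    rw [norm_mul]
    gcongr
    exact (ψ.norm_le_seminorm ℝ x).trans hψ.le
  · exact (continuous_const.mul (TemperedDistribution.delta x).continuous).continuousAt

/-- An identity between a locally integrable function and a continuous functional extends from
a dense set of test functions supported in a ball. -/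
lemma integral_eq_of_mem_closure {w : E3 → ℂ} (hw : LocallyIntegrable w) {N : ℝ}
    {Q : Set 𝓢(E3, ℂ)} (hQ : Q ⊆ schwartzBall N) {T : 𝓢(E3, ℂ) → ℂ} (hT : Continuous T)
    (h : ∀ φ ∈ Q, ∫ x, w x * φ x = T φ) {φ : 𝓢(E3, ℂ)} (hφ : φ ∈ schwartzBall N)
    (hφQ : φ ∈ closure Q) : ∫ x, w x * φ x = T φ := by
  set B := Metric.closedBall (0 : E3) N
  have hB : MeasurableSet B := measurableSet_closedBall
  have hwB : Integrable (B.indicator w) :=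
    (integrable_indicator_iff hB).2 (hw.integrableOn_isCompact (isCompact_closedBall _ _))
  have e : ∀ ψ ∈ schwartzBall N, ∫ x, w x * ψ x = ∫ x, B.indicator w x * ψ x := by
    intro ψ hψ
    refine integral_congr_ae (Filter.Eventually.of_forall fun x => ?_)
    by_cases hx : x ∈ B
    · simp [hx]
    · have : ψ x = 0 := by
        by_contra h0
        exact hx (hψ (subset_tsupport _ h0))
      simp [this]
  rw [e φ hφ]
  have hcl : IsClosed {ψ : 𝓢(E3, ℂ) | ∫ x, B.indicator w x * ψ x = T ψ} :=
    isClosed_eq (continuous_integral_mul_schwartz hwB) hT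
  exact hcl.closure_subset_iff.2 (fun ψ hψ => (e ψ (hQ hψ)).symm.trans (h ψ hψ)) hφQ

section Source

variable {Ω : Type*} [MeasurableSpace Ω] {P : Measure Ω} [IsProbabilityMeasure P]
  {D : Set E3} {m : ℝ} {μ : E3 → ℝ} {f : Ω → 𝓢'(E3, ℂ)}

/-- Almost surely, the resolvent of the source is a function which lies in `L²_{-1/2-ε}` for every
`ε > 0`; it has a jointly measurable version. -/
theorem IsMicrolocallyIsotropic.exists_resolvent (hf : IsMicrolocallyIsotropic P f m μ D)
    (hm : 0 ≤ m) (hD : Bornology.IsBounded D) (k : ℝ) :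
    ∃ F : Ω → E3 → ℂ, Measurable (Function.uncurry F) ∧
      ∀ᵐ ω ∂P, IsResolventOf k (f ω) (F ω) ∧ ∀ ε : ℝ, 0 < ε → MemWeighted 2 (-1 / 2 - ε) (F ω) := by
  obtain ⟨R, hR0, hR⟩ := hD.subset_ball_lt 0 0
  set b : ContDiffBump (0 : E3) := ⟨R, R + 1, hR0, by linarith⟩
  set χ : E3 → ℂ := fun x => (b x : ℂ)
  have hχ : ContDiff ℝ (⊤ : ℕ∞) χ := Complex.ofRealCLM.contDiff.comp b.contDiff
  have hχc : HasCompactSupport χ := b.hasCompactSupport.comp_left Complex.ofReal_zero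
  have hχt : χ.HasTemperateGrowth := hχc.hasTemperateGrowth hχ
  have hχ1 : ∀ x, ‖χ x‖ ≤ 1 := fun x => by
    rw [Complex.norm_real, Real.norm_of_nonneg b.nonneg]
    exact b.le_one
  have hχR : Function.support χ ⊆ Metric.ball 0 (R + 1) := by
    intro x hx
    have : x ∈ Function.support b := fun h => hx (by simp [χ, h])
    rwa [b.support_eq] at this
  have hχD : ∀ x ∈ Metric.ball (0 : E3) R, χ x = 1 := fun x hx => by
    have : b x = 1 := b.one_of_mem_closedBall (Metric.ball_subset_closedBall hx)
    simp [χ, this]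
  obtain ⟨X, hX⟩ := hf.exists_L2_extension hm hχ hχc hχ1
  obtain ⟨C, κ, hC0, hκ, hκle⟩ := exists_localized_kernel k hχ.continuous hχ1 hχR
  have hsq : ∀ x, (Real.sqrt C * bracket x ^ (-1 : ℝ)) ^ 2 = C * bracket x ^ (-2 : ℝ) := fun x => by
    rw [mul_pow, Real.sq_sqrt hC0, ← Real.rpow_mul_natCast (bracket_pos x).le]
    norm_num
  -- The bound on the kernel and the auxiliary weight `⟨x⟩⁻¹` together give `C⟨x⟩⁻⁴`, integrable
  -- since `4 > 3`.
  obtain ⟨F, hFm, hF2, hFφ⟩ := exists_measurable_version P (volume : Measure E3) X κ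
    (fun h => measurable_inner_localized_kernel hχ.continuous hκ h)
    (fun x => Real.sqrt C * bracket x ^ (-1 : ℝ)) hκle (fun x => bracket x ^ (-1 : ℝ))
    (continuous_bracket_rpow _).measurable (fun x => bracket_rpow_pos x _) (by
      refine Integrable.lintegral_lt_top ?_
      refine ((integrable_bracket_rpow (r := -4) (by norm_num)).const_mul C).congr
        (Filter.Eventually.of_forall fun x => ?_)
      simp only
      rw [hsq, ← Real.rpow_mul_natCast (bracket_pos x).le, mul_left_comm,
        ← Real.rpow_add (bracket_pos x)]
      norm_num)
  refine ⟨F, hFm, ?_⟩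
  have hFω : ∀ ω, Measurable (F ω) := fun ω => hFm.comp measurable_prodMk_left
  -- integrability
  have hint : ∀ᵐ ω ∂P, ∀ n : ℕ, ∫⁻ x, ENNReal.ofReal (bracket x ^ (2 * (-1 / 2 - 1 / ((n : ℝ) + 1)))) *
      ‖F ω x‖ₑ ^ 2 < ∞ := by
    refine ae_all_iff.2 fun n => ?_
    have hv : Measurable fun x : E3 => ENNReal.ofReal (bracket x ^ (2 * (-1 / 2 - 1 / ((n : ℝ) + 1)))) :=
      (continuous_bracket_rpow _).measurable.ennreal_ofReal
    have h1 := hF2 _ hv fun x => ENNReal.ofReal_ne_top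
    refine ae_lt_top' ?_ (h1.trans_lt (ENNReal.mul_lt_top (by finiteness) ?_)).ne
    · have : Measurable fun p : Ω × E3 =>
          ENNReal.ofReal (bracket p.2 ^ (2 * (-1 / 2 - 1 / ((n : ℝ) + 1)))) * ‖F p.1 p.2‖ₑ ^ 2 :=
        (hv.comp measurable_snd).mul (hFm.enorm.pow_const 2)
      exact this.lintegral_prod_right'.aemeasurable
    · have hn : 0 < 1 / ((n : ℝ) + 1) := by positivity
      have h2 := (integrable_bracket_rpow (r := -3 - 2 * (1 / ((n : ℝ) + 1)))
        (by linarith)).const_mul C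
      refine lt_of_le_of_lt (le_of_eq (lintegral_congr fun x => ?_)) h2.lintegral_lt_top
      rw [hsq, ← ENNReal.ofReal_mul (bracket_rpow_pos x _).le, mul_left_comm,
        ← Real.rpow_add (bracket_pos x)]
      ring_nf
  have hmem : ∀ᵐ ω ∂P, ∀ ε : ℝ, 0 < ε → MemWeighted 2 (-1 / 2 - ε) (F ω) := by
    filter_upwards [hint] with ω hω ε hε
    obtain ⟨n, hn⟩ := exists_nat_one_div_lt hε
    refine MemWeighted.of_le (δ := -1 / 2 - 1 / ((n : ℝ) + 1)) (by linarith) ?_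
    rw [memWeighted_iff, weightedNorm_lt_top_iff]
    exact ⟨(hFω ω).aestronglyMeasurable, hω n⟩
  -- the pairing with test functions
  set S : ℕ → 𝓢(E3, ℂ) →L[ℂ] 𝓢(E3, ℂ) := fun N =>
    SchwartzMap.smulLeftCLM ℂ χ ∘L truncResolvent k (R + 1 + N + 1)
  have hS : ∀ N : ℕ, ∀ φ ∈ schwartzBall N, ∀ y, S N φ y = χ y * ∫ x, Phi k x y * φ x := by
    intro N φ hφ y
    have e : S N φ y = χ y * truncResolvent k (R + 1 + N + 1) φ y :=
      SchwartzMap.smulLeftCLM_apply_apply hχt _ y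
    rw [e]
    by_cases hy : y ∈ Metric.ball (0 : E3) (R + 1)
    · rw [truncResolvent_apply (r := R + 1) (N := N) (by linarith) hφ (mem_ball_zero_iff.1 hy).le]
    · have : χ y = 0 := by
        by_contra h
        exact hy (hχR h)
      simp [this]
  choose Q hQ hQc hQd using fun N : ℕ => exists_countable_dense_schwartzBall (N : ℝ)
  have hpair : ∀ᵐ ω ∂P, ∀ N : ℕ, ∀ φ ∈ Q N, ∫ x, F ω x * φ x
      = f ω (SchwartzMap.smulLeftCLM ℂ χ (S N φ)) := by
    refine ae_all_iff.2 fun N => (ae_ball_iff (hQc N)).2 fun φ hφ => ?_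
    have h1 := hFφ φ φ.continuous.measurable ?_ ((S N φ).toLp 2) fun h =>
      inner_toLp_eq_integral_inner_kernel hχ.continuous hκ (B := Real.sqrt C) (fun x => ?_)
        (hS N φ (hQ N hφ)) h
    · filter_upwards [h1, hX (S N φ)] with ω h2 h3
      rw [h2, h3]
    · have h2 : Function.support φ ⊆ Metric.closedBall (0 : E3) N :=
        (subset_tsupport _).trans (hQ N hφ)
      have h3 : Continuous fun x : E3 => (bracket x ^ (1 : ℝ)) ^ 2 * ‖φ x‖ ^ 2 :=
        ((continuous_bracket_rpow 1).pow 2).mul (φ.continuous.norm.pow 2)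
      have h4 : HasCompactSupport fun x : E3 => (bracket x ^ (1 : ℝ)) ^ 2 * ‖φ x‖ ^ 2 := by
        refine HasCompactSupport.of_support_subset_isCompact (isCompact_closedBall (0 : E3) N) ?_
        intro x hx
        refine h2 fun h0 => hx ?_
        simp [h0]
      refine lt_of_le_of_lt (le_of_eq (lintegral_congr fun x => ?_))
        (h3.integrable_of_hasCompactSupport h4).lintegral_lt_top
      rw [← Real.rpow_neg (bracket_pos x).le, neg_neg, ENNReal.ofReal_mul (by positivity),
        ← ofReal_norm (φ x), ENNReal.ofReal_pow (norm_nonneg _)]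
    · refine (hκle x).trans (mul_le_of_le_one_right (Real.sqrt_nonneg _) ?_)
      exact Real.rpow_le_one_of_one_le_of_nonpos (one_le_bracket x) (by norm_num)
  filter_upwards [hmem, hpair, hf.support] with ω h1 h2 h3
  have hloc : LocallyIntegrable (F ω) := (h1 1 one_pos).locallyIntegrable
  refine ⟨⟨hloc, fun φ hφ hφc => ?_⟩, h1⟩
  obtain ⟨r, hr⟩ := hφc.isCompact.isBounded.subset_closedBall 0
  obtain ⟨N, hN⟩ := exists_nat_ge r
  have hφN : hφc.toSchwartzMap hφ ∈ schwartzBall N := hr.trans (Metric.closedBall_subset_closedBall hN)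
  -- The cutoff occurs twice, once in the kernel and once in `X`. This does no harm, as `χ = 1` on a
  -- ball containing the support of `f ω`.
  refine ⟨SchwartzMap.smulLeftCLM ℂ χ (S N (hφc.toSchwartzMap hφ)), ?_, ?_⟩
  · filter_upwards [Metric.isOpen_ball.mem_nhdsSet.2 (h3.trans hR)] with y hy
    rw [SchwartzMap.smulLeftCLM_apply_apply hχt, hS N _ hφN, hχD y hy, one_smul, one_mul]
    rfl
  · exact integral_eq_of_mem_closure hloc (hQ N)
      (T := fun φ => f ω (SchwartzMap.smulLeftCLM ℂ χ (S N φ))) (by fun_prop) (h2 N) hφN (hQd N hφN)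

end Source

/-! ### Calculus of weighted norms -/

section WeightedNorm

variable {δ : ℝ} {φ ψ : E3 → ℂ}

lemma MemWeighted.norm_lt_top (hφ : MemWeighted 2 δ φ) : weightedNorm 2 δ φ < ∞ := hφ.2

lemma MemWeighted.add (hφ : MemWeighted 2 δ φ) (hψ : MemWeighted 2 δ ψ) :
    MemWeighted 2 δ fun x => φ x + ψ x := by
  have := MemLp.add hφ hψ
  simpa only [MemWeighted, mul_add] using! this

lemma MemWeighted.sub (hφ : MemWeighted 2 δ φ) (hψ : MemWeighted 2 δ ψ) :
    MemWeighted 2 δ fun x => φ x - ψ x := by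
  have := MemLp.sub hφ hψ
  simpa only [MemWeighted, mul_sub] using! this

lemma MemWeighted.const_mul (hφ : MemWeighted 2 δ φ) (c : ℂ) : MemWeighted 2 δ fun x => c * φ x := by
  have := MemLp.const_mul hφ c
  simpa only [MemWeighted, mul_left_comm] using! this

lemma memWeighted_zero : MemWeighted 2 δ fun _ => 0 := by
  simp [MemWeighted]

lemma MemWeighted.sum {ι : Type*} {a : ι → E3 → ℂ} (h : ∀ i, MemWeighted 2 δ (a i)) (s : Finset ι) :
    MemWeighted 2 δ fun x => ∑ i ∈ s, a i x := by
  classical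
  induction s using Finset.induction_on with
  | empty => simpa using memWeighted_zero
  | insert i s hi ih => simpa only [Finset.sum_insert hi] using (h i).add ih

lemma MemWeighted.congr (hφ : MemWeighted 2 δ φ) (h : φ =ᵐ[volume] ψ) : MemWeighted 2 δ ψ := by
  refine (memLp_congr_ae ?_).1 hφ
  filter_upwards [h] with x hx
  rw [hx]

lemma weightedNorm_congr (h : φ =ᵐ[volume] ψ) : weightedNorm 2 δ φ = weightedNorm 2 δ ψ := by
  refine eLpNorm_congr_ae ?_
  filter_upwards [h] with x hx
  rw [hx]

lemma weightedNorm_sub_le (hφ : MemWeighted 2 δ φ) (hψ : MemWeighted 2 δ ψ) :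
    weightedNorm 2 δ (fun x => φ x - ψ x) ≤ weightedNorm 2 δ φ + weightedNorm 2 δ ψ := by
  have := eLpNorm_sub_le (p := 2) hφ.1 hψ.1 (by norm_num)
  simpa only [weightedNorm, mul_sub] using! this

lemma weightedNorm_const_mul (c : ℂ) (φ : E3 → ℂ) :
    weightedNorm 2 δ (fun x => c * φ x) = ‖c‖ₑ * weightedNorm 2 δ φ := by
  have := eLpNorm_const_smul c (fun x => ((bracket x ^ δ : ℝ) : ℂ) * φ x) 2 volume
  rw [weightedNorm, weightedNorm, ← this]
  congr 1
  ext x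
  simp only [Pi.smul_apply, smul_eq_mul]
  ring

lemma ae_eq_zero_of_weightedNorm (hφ : MemWeighted 2 δ φ) (h : weightedNorm 2 δ φ = 0) :
    φ =ᵐ[volume] fun _ => 0 := by
  rw [weightedNorm, eLpNorm_eq_zero_iff hφ.1 (by norm_num)] at h
  filter_upwards [h] with x hx
  have := (bracket_rpow_pos x δ).ne'
  simpa [this] using hx

/-- Geometrically decaying series converge in `L²_δ`, and pointwise almost everywhere. -/
lemma exists_sum_of_geometric {q : ℝ≥0∞} (hq : q < 1) {a : ℕ → E3 → ℂ}
    (ha : ∀ n, MemWeighted 2 δ (a n))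
    (hle : ∀ n, weightedNorm 2 δ (a n) ≤ q ^ n * weightedNorm 2 δ (a 0)) :
    ∃ w : E3 → ℂ, MemWeighted 2 δ w ∧
      (∀ᵐ x, Filter.Tendsto (fun N => ∑ i ∈ Finset.range N, a i x) Filter.atTop (𝓝 (w x))) ∧
      Filter.Tendsto (fun N => weightedNorm 2 δ fun x => w x - ∑ i ∈ Finset.range N, a i x)
        Filter.atTop (𝓝 0) := by
  set g : ℕ → Lp ℂ 2 (volume : Measure E3) := fun n => MemLp.toLp _ (ha n)
  have hg : ∀ n, g n =ᵐ[volume] fun x => ((bracket x ^ δ : ℝ) : ℂ) * a n x := fun n =>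
    MemLp.coeFn_toLp (ha n)
  have hgn : ∀ n, ‖g n‖ₑ = weightedNorm 2 δ (a n) := fun n => Lp.enorm_toLp (ha n)
  have hsum : ∑' n, ‖g n‖ₑ ≠ ∞ := by
    simp only [hgn]
    refine ((ENNReal.tsum_le_tsum hle).trans_lt ?_).ne
    rw [ENNReal.tsum_mul_right, ENNReal.tsum_geometric]
    exact ENNReal.mul_lt_top (ENNReal.inv_lt_top.2 (tsub_pos_of_lt hq)) (ha 0).norm_lt_top
  have hne : ∀ x : E3, ((bracket x ^ δ : ℝ) : ℂ) ≠ 0 := fun x => by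
    exact_mod_cast (bracket_rpow_pos x δ).ne'
  set S := ∑' n, g n
  set w : E3 → ℂ := fun x => ((bracket x ^ δ : ℝ) : ℂ)⁻¹ * S x
  have hw : ∀ x, ((bracket x ^ δ : ℝ) : ℂ) * w x = S x := fun x => mul_inv_cancel_left₀ (hne x) _
  refine ⟨w, ?_, ?_, ?_⟩
  · simp only [MemWeighted, hw]
    exact Lp.memLp S
  · filter_upwards [Lp.hasSum_coeFn_tsum hsum, ae_all_iff.2 hg] with x hx hx2
    have h1 := (hx.tendsto_sum_nat).const_mul (((bracket x ^ δ : ℝ) : ℂ)⁻¹)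
    refine h1.congr fun N => ?_
    rw [Finset.mul_sum]
    refine Finset.sum_congr rfl fun i _ => ?_
    rw [hx2, inv_mul_cancel_left₀ (hne x)]
  · have h1 : Filter.Tendsto (fun N => ‖S - ∑ i ∈ Finset.range N, g i‖ₑ) Filter.atTop (𝓝 0) := by
      have h2 : Filter.Tendsto (fun N => ∑ i ∈ Finset.range N, g i) Filter.atTop (𝓝 S) :=
        Summable.tendsto_sum_tsum_nat (Summable.of_enorm hsum)
      have h3 := (h2.const_sub S).enorm
      simpa using h3
    refine h1.congr fun N => ?_
    rw [Lp.enorm_def]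
    refine eLpNorm_congr_ae ?_
    filter_upwards [Lp.coeFn_sub S (∑ i ∈ Finset.range N, g i),
      Lp.coeFn_fun_finsetSum (Finset.range N) g, ae_all_iff.2 hg] with x h2 h3 h4
    rw [h2, Pi.sub_apply, h3, mul_sub, hw, Finset.mul_sum]
    simp only [h4]

end WeightedNorm

/-! ### The operator `R_k V` -/

section ResolventV

variable {k ε : ℝ} {V φ ψ : E3 → ℂ}

lemma resolventV_congr (h : φ =ᵐ[volume] ψ) : resolventV k V φ = resolventV k V ψ := by
  ext x
  refine integral_congr_ae ?_
  filter_upwards [h] with y hy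
  simp only [hy]

lemma resolventV_const_mul (c : ℂ) (φ : E3 → ℂ) (x : E3) :
    resolventV k V (fun y => c * φ y) x = c * resolventV k V φ x := by
  simp only [resolventV, resolvent]
  rw [← integral_const_mul]
  congr 1
  ext y
  ring

/-- The parameter space `β` is there to hold `Ω`: it yields joint measurability in `(ω, x)`. -/
lemma measurable_resolvent {β : Type*} [MeasurableSpace β] (k : ℝ) {g : β → E3 → ℂ}
    (hg : Measurable (Function.uncurry g)) :
    Measurable fun p : β × E3 => resolvent k (g p.1) p.2 := by
  have h1 : Measurable fun p : (β × E3) × E3 => Phi k p.1.2 p.2 := by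
    unfold Phi
    fun_prop
  have h2 : Measurable fun p : (β × E3) × E3 => Function.uncurry g (p.1.1, p.2) := by
    fun_prop
  have h3 : StronglyMeasurable fun p : (β × E3) × E3 => Phi k p.1.2 p.2 * Function.uncurry g (p.1.1, p.2) :=
    (h1.mul h2).stronglyMeasurable
  have h4 := h3.integral_prod_right' (ν := (volume : Measure E3))
  exact h4.measurable

lemma aestronglyMeasurable_resolvent (k : ℝ) {g : E3 → ℂ} (hg : AEStronglyMeasurable g) :
    AEStronglyMeasurable (resolvent k g) := by
  have e : resolvent k g = resolvent k (hg.mk g) := by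
    ext x
    refine integral_congr_ae ?_
    filter_upwards [hg.ae_eq_mk] with y hy
    rw [hy]
  rw [e]
  have h := measurable_resolvent (β := Unit) k (g := fun _ => hg.mk g)
    (hg.stronglyMeasurable_mk.measurable.comp measurable_snd)
  exact (h.comp (measurable_prodMk_left (x := ()))).aestronglyMeasurable

lemma measurable_absPotential (k : ℝ) {g : E3 → ℂ} (hg : AEStronglyMeasurable g) :
    Measurable (absPotential k g) := by
  have e : absPotential k g = absPotential k (hg.mk g) := by
    ext x
    refine lintegral_congr_ae ?_
    filter_upwards [hg.ae_eq_mk] with y hy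
    rw [hy]
  rw [e]
  have h1 : Measurable (hg.mk g) := hg.stronglyMeasurable_mk.measurable
  have hΦ := measurable_Phi k
  have h2 : Measurable fun p : E3 × E3 => ‖Phi k p.1 p.2‖ₑ * ‖hg.mk g p.2‖ₑ := by fun_prop
  exact h2.lintegral_prod_right'

/-- The weights `1/2 + ε` and `-1/2 - ε` cancel in Hölder's inequality `L^∞ · L² ⊆ L²`. -/
lemma IsAdmissiblePotential.memLp_mul (hV : IsAdmissiblePotential ε V)
    (hφ : MemWeighted 2 (-1 / 2 - ε) φ) : MemLp (fun y => V y * φ y) 2 := by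
  have h0 := hV.mem_Linfty 0 (by norm_num) Fin.elim0
  have h1 : MemLp (fun y => (((bracket y ^ (1 / 2 + ε) : ℝ) : ℂ) * V y) *
      (((bracket y ^ (-1 / 2 - ε) : ℝ) : ℂ) * φ y)) 2 volume := by
    refine MemLp.mul' (p := ∞) (q := 2) hφ ?_
    simpa [MemWeighted, partialDeriv] using h0
  refine (memLp_congr_ae (Filter.Eventually.of_forall fun y => ?_)).1 h1
  have e : ((bracket y ^ (1 / 2 + ε) : ℝ) : ℂ) * ((bracket y ^ (-1 / 2 - ε) : ℝ) : ℂ) = 1 := by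
    rw [← Complex.ofReal_mul, ← Real.rpow_add (bracket_pos y)]
    ring_nf
    simp
  linear_combination (V y * φ y) * e

/-- The weights `3/2 + ε` and `-1/2 - ε` add up to `1`, and `L² · L² ⊆ L¹`. -/
lemma IsAdmissiblePotential.lintegral_bracket_mul_lt_top (hV : IsAdmissiblePotential ε V)
    (hφ : MemWeighted 2 (-1 / 2 - ε) φ) :
    ∫⁻ y, ENNReal.ofReal (bracket y) * ‖V y * φ y‖ₑ < ∞ := by
  have h1 := (MemLp.integrable_mul hV.mem_L2 hφ).2
  refine lt_of_le_of_lt (le_of_eq (lintegral_congr fun y => ?_)) h1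
  have e : ((bracket y ^ (3 / 2 + ε) : ℝ) : ℂ) * ((bracket y ^ (-1 / 2 - ε) : ℝ) : ℂ) =
      (bracket y : ℂ) := by
    rw [← Complex.ofReal_mul, ← Real.rpow_add (bracket_pos y)]
    ring_nf
    simp
  have e2 : ENNReal.ofReal (bracket y) = ‖(bracket y : ℂ)‖ₑ := by
    rw [← ofReal_norm, Complex.norm_real, Real.norm_of_nonneg (bracket_pos y).le]
  rw [e2, ← enorm_mul]
  congr 1
  simp only [Pi.mul_apply]
  linear_combination -(V y * φ y) * e

/-- The integral defining the resolvent is `0` by convention where it diverges, so `R_k V` is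
additive only at points of absolute convergence. Finiteness of a weighted square integral of the
absolute potential makes these almost all points. -/
lemma IsAdmissiblePotential.ae_integrable (hV : IsAdmissiblePotential ε V) (k : ℝ)
    (hφ : MemWeighted 2 (-1 / 2 - ε) φ) :
    ∀ᵐ x, Integrable fun y => Phi k x y * (V y * φ y) := by
  have hg := hV.memLp_mul hφ
  have h := lintegral_absPotential_lt_top k hg (hV.lintegral_bracket_mul_lt_top hφ) one_pos
  have hm : Measurable fun x => ENNReal.ofReal (bracket x ^ (2 * (-1 / 2 - 1 : ℝ))) *
      absPotential k (fun y => V y * φ y) x ^ 2 :=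
    (continuous_bracket_rpow _).measurable.ennreal_ofReal.mul
      ((measurable_absPotential k hg.1).pow_const 2)
  filter_upwards [ae_lt_top hm h.ne] with x hx
  refine integrable_of_absPotential_lt_top hg.1 ?_
  by_contra h2
  rw [not_lt, top_le_iff] at h2
  rw [h2] at hx
  have := bracket_rpow_pos x (2 * (-1 / 2 - 1 : ℝ))
  simp [ENNReal.mul_top, this] at hx

/-- `R_k V` maps `L²_{-1/2-ε}` into `L²_{-1/2-ε'}` for every `ε' > 0`. -/
lemma IsAdmissiblePotential.memWeighted_resolventV (hV : IsAdmissiblePotential ε V) (k : ℝ)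
    (hφ : MemWeighted 2 (-1 / 2 - ε) φ) {ε' : ℝ} (hε' : 0 < ε') :
    MemWeighted 2 (-1 / 2 - ε') (resolventV k V φ) := by
  have hg := hV.memLp_mul hφ
  rw [memWeighted_iff, weightedNorm_lt_top_iff]
  refine ⟨aestronglyMeasurable_resolvent k hg.1, lt_of_le_of_lt (lintegral_mono fun x => ?_)
    (lintegral_absPotential_lt_top k hg (hV.lintegral_bracket_mul_lt_top hφ) hε')⟩
  gcongr
  exact enorm_resolvent_le k _ x

lemma IsAdmissiblePotential.resolventV_add (hV : IsAdmissiblePotential ε V) (k : ℝ)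
    (hφ : MemWeighted 2 (-1 / 2 - ε) φ) (hψ : MemWeighted 2 (-1 / 2 - ε) ψ) :
    resolventV k V (fun y => φ y + ψ y) =ᵐ[volume] fun x => resolventV k V φ x + resolventV k V ψ x := by
  filter_upwards [hV.ae_integrable k hφ, hV.ae_integrable k hψ] with x h1 h2
  simp only [resolventV, resolvent]
  rw [← integral_add h1 h2]
  congr 1
  ext y
  ring

lemma IsAdmissiblePotential.resolventV_sub (hV : IsAdmissiblePotential ε V) (k : ℝ)
    (hφ : MemWeighted 2 (-1 / 2 - ε) φ) (hψ : MemWeighted 2 (-1 / 2 - ε) ψ) :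
    resolventV k V (fun y => φ y - ψ y) =ᵐ[volume] fun x => resolventV k V φ x - resolventV k V ψ x := by
  filter_upwards [hV.ae_integrable k hφ, hV.ae_integrable k hψ] with x h1 h2
  simp only [resolventV, resolvent]
  rw [← integral_sub h1 h2]
  congr 1
  ext y
  ring

/-- Homogeneity reduces to the unit ball. If the norm of `φ` vanishes, then `φ = 0` almost
everywhere and both sides are zero. -/
lemma weightedNorm_resolventV_le {δ : ℝ} (k : ℝ) (V : E3 → ℂ) (hφ : MemWeighted 2 δ φ) :
    weightedNorm 2 δ (resolventV k V φ) ≤ opNormResolventV k V δ * weightedNorm 2 δ φ := by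
  set M := weightedNorm 2 δ φ
  have hM : M < ∞ := hφ.norm_lt_top
  by_cases h0 : M = 0
  · rw [resolventV_congr (ae_eq_zero_of_weightedNorm hφ h0)]
    simp [resolventV, weightedNorm, resolvent]
  · have hr : 0 < M.toReal := ENNReal.toReal_pos h0 hM.ne
    have hMr : ‖(M.toReal : ℂ)‖ₑ = M := by
      rw [← ofReal_norm, Complex.norm_real, Real.norm_of_nonneg hr.le, ENNReal.ofReal_toReal hM.ne]
    have hc : ‖((M.toReal : ℂ))⁻¹‖ₑ = M⁻¹ := by
      rw [enorm_inv (by exact_mod_cast hr.ne'), hMr]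
    set φ₁ : E3 → ℂ := fun x => (M.toReal : ℂ)⁻¹ * φ x
    have h1 : weightedNorm 2 δ φ₁ ≤ 1 := by
      rw [weightedNorm_const_mul, hc]
      exact (ENNReal.inv_mul_cancel h0 hM.ne).le
    have h2 : weightedNorm 2 δ (resolventV k V φ₁) ≤ opNormResolventV k V δ :=
      le_iSup (fun φ : {φ : E3 → ℂ // MemWeighted 2 δ φ ∧ weightedNorm 2 δ φ ≤ 1} =>
        weightedNorm 2 δ (resolventV k V φ.1)) ⟨φ₁, hφ.const_mul _, h1⟩
    have h3 : resolventV k V φ₁ = fun x => (M.toReal : ℂ)⁻¹ * resolventV k V φ x := by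
      ext x
      exact resolventV_const_mul _ _ _
    rw [h3, weightedNorm_const_mul, hc] at h2
    calc weightedNorm 2 δ (resolventV k V φ)
        = M⁻¹ * weightedNorm 2 δ (resolventV k V φ) * M := by
          rw [mul_comm, ← mul_assoc, ENNReal.mul_inv_cancel h0 hM.ne, one_mul]
      _ ≤ _ := by gcongr

/-! ### Contraction: stability and the Neumann series. -/

variable {F G u v : E3 → ℂ}

/-- Stability of the Lippmann–Schwinger equation when `R_k V` is a contraction. -/
lemma IsAdmissiblePotential.weightedNorm_sub_le_of_lippmannSchwinger (hV : IsAdmissiblePotential ε V)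
    (hq : opNormResolventV k V (-1 / 2 - ε) < 1) (hε : 0 < ε)
    (hF : MemWeighted 2 (-1 / 2 - ε) F) (hG : MemWeighted 2 (-1 / 2 - ε) G)
    (hu : MemWeighted 2 (-1 / 2 - ε) u) (hv : MemWeighted 2 (-1 / 2 - ε) v)
    (hLu : LippmannSchwinger k V F u) (hLv : LippmannSchwinger k V G v) :
    weightedNorm 2 (-1 / 2 - ε) (fun x => u x - v x) ≤
      (1 - opNormResolventV k V (-1 / 2 - ε))⁻¹ * weightedNorm 2 (-1 / 2 - ε) (fun x => F x - G x) := by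
  set q := opNormResolventV k V (-1 / 2 - ε)
  set d : E3 → ℂ := fun x => u x - v x
  have hd : MemWeighted 2 (-1 / 2 - ε) d := hu.sub hv
  have hFG := hF.sub hG
  have e : d =ᵐ[volume] fun x => resolventV k V d x - (F x - G x) := by
    filter_upwards [hLu, hLv, hV.resolventV_sub k hu hv] with x h1 h2 h3
    rw [h3]
    simp only [d]
    linear_combination h1 - h2
  have h1 : weightedNorm 2 (-1 / 2 - ε) d ≤ q * weightedNorm 2 (-1 / 2 - ε) d +
      weightedNorm 2 (-1 / 2 - ε) (fun x => F x - G x) := by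
    calc weightedNorm 2 (-1 / 2 - ε) d = _ := weightedNorm_congr e
      _ ≤ _ := (weightedNorm_sub_le (hV.memWeighted_resolventV k hd hε) hFG).trans
        (add_le_add (weightedNorm_resolventV_le k V hd) le_rfl)
  have hdt := hd.norm_lt_top
  -- Absorbing `q‖d‖` into the left side is legitimate because `‖d‖` is finite.
  have h2 : (1 - q) * weightedNorm 2 (-1 / 2 - ε) d ≤
      weightedNorm 2 (-1 / 2 - ε) (fun x => F x - G x) := by
    rw [ENNReal.sub_mul fun _ _ => hdt.ne, one_mul]
    exact tsub_le_iff_left.2 h1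
  have h3 : (1 - q) ≠ 0 := (tsub_pos_of_lt hq).ne'
  have h4 : (1 - q) ≠ ∞ := by finiteness
  calc weightedNorm 2 (-1 / 2 - ε) d
      = (1 - q)⁻¹ * ((1 - q) * weightedNorm 2 (-1 / 2 - ε) d) := by
        rw [← mul_assoc, ENNReal.inv_mul_cancel h3 h4, one_mul]
    _ ≤ _ := by gcongr

/-- Reference solution: comparison with it turns the difference estimate into the norm bound on `u`.
-/
lemma lippmannSchwinger_zero (k : ℝ) (V : E3 → ℂ) :
    LippmannSchwinger k V (fun _ => 0) (fun _ => 0) := by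
  refine Filter.Eventually.of_forall fun x => ?_
  simp [resolventV, resolvent]

/-- The iterates of `R_k V`. -/
def neumannIterate (k : ℝ) (V F : E3 → ℂ) : ℕ → E3 → ℂ
  | 0 => F
  | n + 1 => resolventV k V (neumannIterate k V F n)

/-- The partial sums of the Neumann series converge to a solution of the Lippmann–Schwinger
equation. -/
lemma IsAdmissiblePotential.exists_neumann_limit (hV : IsAdmissiblePotential ε V)
    (hq : opNormResolventV k V (-1 / 2 - ε) < 1) (hε : 0 < ε) (hF : MemWeighted 2 (-1 / 2 - ε) F) :
    ∃ w : E3 → ℂ, MemWeighted 2 (-1 / 2 - ε) w ∧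
      (∀ᵐ x, Filter.Tendsto (fun N => ∑ i ∈ Finset.range N, neumannIterate k V F i x) Filter.atTop
        (𝓝 (w x))) ∧
      ∀ᵐ x, w x - resolventV k V w x = F x := by
  set q := opNormResolventV k V (-1 / 2 - ε)
  set a := neumannIterate k V F
  have ha : ∀ n, MemWeighted 2 (-1 / 2 - ε) (a n) := fun n => by
    induction n with
    | zero => exact hF
    | succ n ih => exact hV.memWeighted_resolventV k ih hε
  have hle : ∀ n, weightedNorm 2 (-1 / 2 - ε) (a n) ≤ q ^ n * weightedNorm 2 (-1 / 2 - ε) (a 0) := by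
    intro n
    induction n with
    | zero => simp
    | succ n ih =>
      calc weightedNorm 2 (-1 / 2 - ε) (a (n + 1)) ≤ q * weightedNorm 2 (-1 / 2 - ε) (a n) :=
            weightedNorm_resolventV_le k V (ha n)
        _ ≤ q * (q ^ n * weightedNorm 2 (-1 / 2 - ε) (a 0)) := by gcongr
        _ = _ := by rw [pow_succ']; ring
  obtain ⟨w, hw, hlim, hnorm⟩ := exists_sum_of_geometric hq ha hle
  refine ⟨w, hw, hlim, ?_⟩
  set s : ℕ → E3 → ℂ := fun N x => ∑ i ∈ Finset.range N, a i x
  have hs : ∀ N, MemWeighted 2 (-1 / 2 - ε) (s N) := fun N => MemWeighted.sum ha _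
  have hAs : ∀ N, resolventV k V (s N) =ᵐ[volume] fun x => ∑ i ∈ Finset.range N, a (i + 1) x := by
    intro N
    induction N with
    | zero =>
      refine Filter.Eventually.of_forall fun x => ?_
      simp [s, resolventV, resolvent]
    | succ N ih =>
      have e : s (N + 1) = fun x => s N x + a N x := by
        ext x
        simp only [s, Finset.sum_range_succ]
      rw [e]
      filter_upwards [hV.resolventV_add k (hs N) (ha N), ih] with x h1 h2
      rw [h1, h2, Finset.sum_range_succ]
      rfl
  set r : ℕ → E3 → ℂ := fun N x => w x - s N x
  have hr : ∀ N, MemWeighted 2 (-1 / 2 - ε) (r N) := fun N => hw.sub (hs N)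
  have hAw := hV.memWeighted_resolventV k hw hε
  -- Telescoping gives `(I - R_k V) s_N = F - a_N`, so the residual `z` equals `(I - R_k V) r_N -
  -- a_N` for every `N`, and both pieces tend to zero in norm.
  set z : E3 → ℂ := fun x => w x - resolventV k V w x - F x
  have hz : MemWeighted 2 (-1 / 2 - ε) z := (hw.sub hAw).sub hF
  have key : ∀ N, weightedNorm 2 (-1 / 2 - ε) z ≤ weightedNorm 2 (-1 / 2 - ε) (r N) +
      q * weightedNorm 2 (-1 / 2 - ε) (r N) + q ^ N * weightedNorm 2 (-1 / 2 - ε) (a 0) := by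
    intro N
    have hAr := hV.memWeighted_resolventV k (hr N) hε
    have e : z =ᵐ[volume] fun x => (r N x - resolventV k V (r N) x) - a N x := by
      filter_upwards [hV.resolventV_sub k hw (hs N), hAs N] with x h1 h2
      have h3 : resolventV k V (r N) x = resolventV k V w x - ∑ i ∈ Finset.range N, a (i + 1) x := by
        rw [← h2]
        exact h1
      have h4 := Finset.sum_range_succ' (fun i => a i x) N
      rw [Finset.sum_range_succ] at h4
      have h5 : a 0 x = F x := rfl
      simp only [z, r, s]
      rw [h3]
      linear_combination h4 + h5
    calc weightedNorm 2 (-1 / 2 - ε) z = _ := weightedNorm_congr e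
      _ ≤ weightedNorm 2 (-1 / 2 - ε) (fun x => r N x - resolventV k V (r N) x)
          + weightedNorm 2 (-1 / 2 - ε) (a N) := weightedNorm_sub_le ((hr N).sub hAr) (ha N)
      _ ≤ _ := add_le_add ((weightedNorm_sub_le (hr N) hAr).trans
          (add_le_add le_rfl (weightedNorm_resolventV_le k V (hr N)))) (hle N)
  have hlim0 : Filter.Tendsto (fun N => weightedNorm 2 (-1 / 2 - ε) (r N) +
      q * weightedNorm 2 (-1 / 2 - ε) (r N) + q ^ N * weightedNorm 2 (-1 / 2 - ε) (a 0))
      Filter.atTop (𝓝 0) := by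
    have h1 := ENNReal.Tendsto.const_mul (a := q) hnorm (Or.inr (hq.trans ENNReal.one_lt_top).ne)
    have h2 := ENNReal.Tendsto.mul_const (b := weightedNorm 2 (-1 / 2 - ε) (a 0))
      (ENNReal.tendsto_pow_atTop_nhds_zero_of_lt_one hq) (Or.inr (ha 0).norm_lt_top.ne)
    simpa using (hnorm.add h1).add h2
  have hz0 : weightedNorm 2 (-1 / 2 - ε) z = 0 :=
    le_antisymm (ge_of_tendsto' hlim0 key) zero_le
  filter_upwards [ae_eq_zero_of_weightedNorm hz hz0] with x hx
  exact sub_eq_zero.1 hx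

lemma measurable_neumannIterate {β : Type*} [MeasurableSpace β] (k : ℝ) (hV : Measurable V)
    {F : β → E3 → ℂ} (hF : Measurable (Function.uncurry F)) (n : ℕ) :
    Measurable fun p : β × E3 => neumannIterate k V (F p.1) n p.2 := by
  induction n with
  | zero => exact hF
  | succ n ih =>
    refine measurable_resolvent k (g := fun b y => V y * neumannIterate k V (F b) n y) ?_
    exact (hV.comp measurable_snd).mul ih

end ResolventV

end RandomSchrodinger

end

/-! ### The mild solution as a jointly measurable Neumann series. -/

theorem mainTheorem5
    {Ω : Type*} [MeasurableSpace Ω] (P : Measure Ω) [IsProbabilityMeasure P]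
    (D : Set RandomSchrodinger.E3) (hD_open : IsOpen D) (hD_conn : IsConnected D)
    (hD_bdd : Bornology.IsBounded D)
    (m : ℝ) (hm : 2 < m) (μ : RandomSchrodinger.E3 → ℝ)
    (f : Ω → 𝓢'(RandomSchrodinger.E3, ℂ))
    (hf : RandomSchrodinger.IsMicrolocallyIsotropic P f m μ D)
    (ε : ℝ) (hε : 0 < ε)
    (V : RandomSchrodinger.E3 → ℂ) (hV : RandomSchrodinger.IsAdmissiblePotential ε V)
    (k : ℝ) (hk : 0 < k)
    (hnorm : RandomSchrodinger.opNormResolventV k V (-1 / 2 - ε) < 1) :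
    -- `F` is `R_k f` and `u` is the mild solution
    ∃ F u : Ω → RandomSchrodinger.E3 → ℂ,
      Measurable (Function.uncurry F) ∧ Measurable (Function.uncurry u) ∧
      (∀ᵐ ω ∂P, RandomSchrodinger.IsResolventOf k (f ω) (F ω) ∧
        RandomSchrodinger.MemWeighted 2 (-1 / 2 - ε) (F ω)) ∧
      -- existence
      (∀ᵐ ω ∂P, RandomSchrodinger.LippmannSchwinger k V (F ω) (u ω) ∧
        RandomSchrodinger.MemWeighted 2 (-1 / 2 - ε) (u ω)) ∧
      (∀ᵐ ω ∂P, ∀ ε' : ℝ, 0 < ε' → RandomSchrodinger.MemWeighted 2 (-1 / 2 - ε') (u ω)) ∧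
      -- uniqueness
      (∀ᵐ ω ∂P, ∀ v : RandomSchrodinger.E3 → ℂ,
        RandomSchrodinger.MemWeighted 2 (-1 / 2 - ε) v →
        RandomSchrodinger.LippmannSchwinger k V (F ω) v → v =ᵐ[volume] u ω) ∧
      -- stability
      (∀ᵐ ω ∂P, RandomSchrodinger.weightedNorm 2 (-1 / 2 - ε) (u ω) ≤
        (1 - RandomSchrodinger.opNormResolventV k V (-1 / 2 - ε))⁻¹ *
          RandomSchrodinger.weightedNorm 2 (-1 / 2 - ε) (F ω)) ∧
      (∀ᵐ ω ∂P, ∀ G v : RandomSchrodinger.E3 → ℂ,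
        RandomSchrodinger.MemWeighted 2 (-1 / 2 - ε) G →
        RandomSchrodinger.MemWeighted 2 (-1 / 2 - ε) v →
        RandomSchrodinger.LippmannSchwinger k V G v →
        RandomSchrodinger.weightedNorm 2 (-1 / 2 - ε) (fun x => u ω x - v x) ≤
          (1 - RandomSchrodinger.opNormResolventV k V (-1 / 2 - ε))⁻¹ *
            RandomSchrodinger.weightedNorm 2 (-1 / 2 - ε) (fun x => F ω x - G x)) := by
  obtain ⟨F, hFm, hF⟩ := hf.exists_resolvent (by linarith) hD_bdd k
  set s : ℕ → Ω × RandomSchrodinger.E3 → ℂ := fun N p =>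
    ∑ i ∈ Finset.range N, RandomSchrodinger.neumannIterate k V (F p.1) i p.2
  have hs : ∀ N, StronglyMeasurable (s N) := fun N =>
    (Finset.measurable_fun_sum _ fun i _ => RandomSchrodinger.measurable_neumannIterate k
      hV.contDiff.continuous.measurable hFm i).stronglyMeasurable
  -- Taking the pointwise limit, rather than choosing an `L²` limit for each `ω`, keeps `u` jointly
  -- measurable. Where the series diverges the value is a default; for almost every `ω` this is a
  -- null set. The sign comes from `-R_k f`.
  set u : Ω → RandomSchrodinger.E3 → ℂ := fun ω x =>
    -Filter.limUnder Filter.atTop fun N => s N (ω, x)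
  have hum : Measurable (Function.uncurry u) :=
    (StronglyMeasurable.limUnder hs).neg.measurable
  have hFε : ∀ᵐ ω ∂P, RandomSchrodinger.MemWeighted 2 (-1 / 2 - ε) (F ω) :=
    hF.mono fun ω h => h.2 ε hε
  have hu : ∀ ω, RandomSchrodinger.MemWeighted 2 (-1 / 2 - ε) (F ω) →
      RandomSchrodinger.LippmannSchwinger k V (F ω) (u ω) ∧
        RandomSchrodinger.MemWeighted 2 (-1 / 2 - ε) (u ω) := by
    intro ω hω
    obtain ⟨w, hw, hlim, hLw⟩ := hV.exists_neumann_limit hnorm hε hω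
    have e : (fun x => (-1 : ℂ) * w x) =ᵐ[volume] u ω := by
      filter_upwards [hlim] with x hx
      rw [neg_one_mul]
      exact congrArg Neg.neg hx.limUnder_eq.symm
    refine ⟨?_, (hw.const_mul (-1)).congr e⟩
    filter_upwards [hLw, e] with x h1 h2
    rw [← RandomSchrodinger.resolventV_congr e, ← h2, RandomSchrodinger.resolventV_const_mul]
    linear_combination -h1
  refine ⟨F, u, hFm, hum, hF.mono fun ω h => ⟨h.1, h.2 ε hε⟩, hFε.mono hu, ?_, ?_, ?_, ?_⟩
  · filter_upwards [hF] with ω hω ε' hε'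
    obtain ⟨hL, hm⟩ := hu ω (hω.2 ε hε)
    -- The equation reads `u = R_k V u - R_k f`, and both terms on the right lie in every
    -- `L²_{-1/2-ε'}`.
    refine ((hV.memWeighted_resolventV k hm hε').sub (hω.2 ε' hε')).congr ?_
    filter_upwards [hL] with x hx
    linear_combination -hx
  · filter_upwards [hFε] with ω hω v hv hLv
    obtain ⟨hL, hm⟩ := hu ω hω
    -- Uniqueness is stability with equal sources.
    have h := hV.weightedNorm_sub_le_of_lippmannSchwinger hnorm hε hω hω hv hm hLv hL
    have h0 : RandomSchrodinger.weightedNorm 2 (-1 / 2 - ε) (fun x => F ω x - F ω x) = 0 := by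
      simp [RandomSchrodinger.weightedNorm]
    rw [h0, mul_zero] at h
    filter_upwards [RandomSchrodinger.ae_eq_zero_of_weightedNorm (hv.sub hm)
      (le_antisymm h zero_le)] with x hx
    exact sub_eq_zero.1 hx
  · filter_upwards [hFε] with ω hω
    obtain ⟨hL, hm⟩ := hu ω hω
    simpa only [sub_zero] using hV.weightedNorm_sub_le_of_lippmannSchwinger hnorm hε hω
      RandomSchrodinger.memWeighted_zero hm RandomSchrodinger.memWeighted_zero hL
      (RandomSchrodinger.lippmannSchwinger_zero k V)
  · filter_upwards [hFε] with ω hω G v hG hv hLv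
    obtain ⟨hL, hm⟩ := hu ω hω
    exact hV.weightedNorm_sub_le_of_lippmannSchwinger hnorm hε hω hG hm hv hL hLv
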